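/- Let $q$ be a prime power, let $t, n_1,\dots,n_t, m_1,\dots,m_t$ be positive integers with $m_1\ge\dots\ge m_t$ and $m_i\ge n_i$ for all $i\in[t]=\{1,\dots,t\}$, and put $n=n_1+\dots+n_t$ and $\mathbb M=\mathbb F_q^{m_1\times n_1}\times\dots\times\mathbb F_q^{m_t\times n_t}$. A code is an $\mathbb F_q$-linear subspace of $\mathbb M$. For $C=(C_1,\dots,C_t)\in\mathbb M$ let $\mathrm{srk}(C)=\sum_i \mathrm{rk}(C_i)$. For a code $\mathcal C$ let $\mathrm{maxsrk}(\mathcal C)=\max\{\mathrm{srk}(C):C\in\mathcal C\}$ and, if $\mathcal C\ne0$, let $d(\mathcal C)=\min\{\mathrm{srk}(C):0\ne C\in\mathcal C\}$. A subspace $\mathcal A_i\subseteq\mathbb F_q^{m_i\times n_i}$ is an optimal anticode if $\dim\mathcal A_i=m_i\cdot\max\{\mathrm{rk}(A):A\in\mathcal A_i\}$. The weight $\mathrm{wt}(\mathcal C)$ of a code is the minimum of $\mathrm{maxsrk}(\mathcal A)$ over all products $\mathcal A=\mathcal A_1\times\dots\times\mathcal A_t\supseteq\mathcal C$ of optimal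 anticodes $\mathcal A_i\subseteq\mathbb F_q^{m_i\times n_i}$. For $1\le r\le\dim\mathcal C$, the $r$-th generalized sum-rank weight is $d_r(\mathcal C)=\min\{\mathrm{wt}(\mathcal D):\mathcal D\subseteq\mathcal C,\ \dim\mathcal D\ge r\}$. A code $\mathcal C$ is MSRD if there are $j\in[t]$ and $0\le\delta\le n_j-1$ with $d(\mathcal C)=\sum_{i=1}^{j-1}n_i+\delta+1$ and $\dim\mathcal C=\sum_{i=j}^t m_in_i-\delta m_j$. A $k$-dimensional code $\mathcal C$ satisfies the chain condition if there are subcodes $0\subsetneq\mathcal D_1\subsetneq\dots\subsetneq\mathcal D_k=\mathcal C$ with $\mathrm{wt}(\mathcal D_r)=d_r(\mathcal C)$ for all $r\in[k]$. A greedy $1$-subcode of $\mathcal C$ is a $1$-dimensional subcode of weight $d_1(\mathcal C)$; for $2\le r\le k$ a greedy $r$-subcode is an $r$-dimensional subcode of $\mathcal C$ of minimum weight among those that contain a greedy $(r-1)$-subcode. The $r$-th greedy weight of $\mathcal C$ is the weight of any greedy $r$-subcode. Theorem. Assume that there is a chain of MSRD codes $\mathbb M=\mathcal D_1\supseteq\mathcal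 D_2\supseteq\dots\supseteq\mathcal D_n$ with $d(\mathcal D_h)=h$ for all $h\in[n]$. 1. A sequence of positive integers $d_1,\dots,d_k$ is the sequence of generalized sum-rank weights $d_1(\mathcal C),\dots,d_k(\mathcal C)$ of a $k$-dimensional code $\mathcal C\subseteq\mathbb M$ if and only if it is a non-decreasing sequence in $[n]$ in which the integer $n_1+\dots+n_{i-1}+j$ appears at most $m_i$ times, for all $i\in[t]$ and $j\in[n_i]$. 2. For every such sequence the code $\mathcal C$ can be chosen so that, in addition, it satisfies the chain condition and $d_1,\dots,d_k$ is also its sequence of greedy weights. 3. In particular, every subsequence of the sequence of generalized sum-rank weights of $\mathbb M$ is the sequence of greedy weights of a code $\mathcal C\subseteq\mathbb M$. -/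

import Mathlib

namespace SumRank

/-- The ambient space `F^{m_1 × n_1} × ⋯ × F^{m_t × n_t}`. A (linear) sum-rank metric code is an
`F`-subspace of it. -/
abbrev Ambient (F : Type*) [Field F] {t : ℕ} (m n : Fin t → ℕ) : Type _ :=
  ∀ i : Fin t, Matrix (Fin (m i)) (Fin (n i)) F

section Codes

variable {F : Type*} [Field F] {t : ℕ} {m n : Fin t → ℕ}

/-- Sum-rank weight of an element. -/
noncomputable def srk (X : Ambient F m n) : ℕ := ∑ i, (X i).rank

/-- Minimum distance of a nonzero code (the value on the zero code is the junk value `0`). -/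
noncomputable def minDist (C : Submodule F (Ambient F m n)) : ℕ :=
  sInf {w | ∃ X ∈ C, X ≠ 0 ∧ srk X = w}

/-- Maximum sum-rank distance of a code; the set is nonempty and bounded by `n_1 + ⋯ + n_t`. -/
noncomputable def maxSrk (C : Submodule F (Ambient F m n)) : ℕ :=
  sSup {w | ∃ X ∈ C, srk X = w}

/-- Optimal anticodes in a single matrix space `F^{a × b}` (used for `b ≤ a`): the codes that
attain the bound `dim A ≤ max {a * rk X : X ∈ A}`. -/
def IsOptimalAnticode {a b : ℕ} (A : Submodule F (Matrix (Fin a) (Fin b) F)) : Prop :=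
  Module.finrank F A = sSup {w | ∃ X ∈ A, a * X.rank = w}

/-- Weight of a code: the least maximum sum-rank distance of a product of optimal anticodes
that contains it. -/
noncomputable def wt (C : Submodule F (Ambient F m n)) : ℕ :=
  sInf {w | ∃ A : ∀ i : Fin t, Submodule F (Matrix (Fin (m i)) (Fin (n i)) F),
    (∀ i, IsOptimalAnticode (A i)) ∧ C ≤ Submodule.pi Set.univ A ∧
      maxSrk (Submodule.pi Set.univ A) = w}

/-- `r`-th generalized sum-rank weight, for `1 ≤ r ≤ dim C`. -/
noncomputable def genWeight (C : Submodule F (Ambient F m n)) (r : ℕ) : ℕ :=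
  sInf {w | ∃ D ≤ C, r ≤ Module.finrank F D ∧ wt D = w}

/-- `d 0, …, d (k-1)` is the sequence of generalized weights `d_1(C), …, d_k(C)`, `k = dim C`. -/
def IsGenWeightSeq (C : Submodule F (Ambient F m n)) {k : ℕ} (d : Fin k → ℕ) : Prop :=
  Module.finrank F C = k ∧ ∀ r : Fin k, genWeight C (r + 1) = d r

/-- Maximum sum-rank distance (MSRD) codes. -/
def IsMSRD (C : Submodule F (Ambient F m n)) : Prop :=
  ∃ j : Fin t, ∃ δ < n j, minDist C = ∑ i ∈ Finset.Iio j, n i + δ + 1 ∧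
    Module.finrank F C + δ * m j = ∑ i ∈ Finset.Ici j, m i * n i

/-- `IsGreedySubcode C r D`: `D` is a greedy `r`-subcode of `C`, for `1 ≤ r ≤ dim C`
(the case `r = 0` is a convention that the other cases do not use). -/
def IsGreedySubcode (C : Submodule F (Ambient F m n)) :
    ℕ → Submodule F (Ambient F m n) → Prop
  | 0, D => D = ⊥
  | 1, D => D ≤ C ∧ Module.finrank F D = 1 ∧ wt D = genWeight C 1
  | r + 2, D =>
      (D ≤ C ∧ Module.finrank F D = r + 2 ∧ ∃ E ≤ D, IsGreedySubcode C (r + 1) E) ∧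
      ∀ D' : Submodule F (Ambient F m n),
        (D' ≤ C ∧ Module.finrank F D' = r + 2 ∧ ∃ E ≤ D', IsGreedySubcode C (r + 1) E) →
          wt D ≤ wt D'

/-- `r`-th greedy weight: the common weight of all greedy `r`-subcodes. -/
noncomputable def greedyWeight (C : Submodule F (Ambient F m n)) (r : ℕ) : ℕ :=
  sInf {w | ∃ D, IsGreedySubcode C r D ∧ wt D = w}

/-- `d 0, …, d (k-1)` is the sequence of greedy weights `g_1(C), …, g_k(C)`, `k = dim C`. -/
def IsGreedyWeightSeq (C : Submodule F (Ambient F m n)) {k : ℕ} (d : Fin k → ℕ) : Prop :=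
  Module.finrank F C = k ∧ ∀ r : Fin k, greedyWeight C (r + 1) = d r

/-- Chain condition: there is a chain `0 = D_0 ⊊ D_1 ⊊ ⋯ ⊊ D_k = C`, `k = dim C`, with
`d_r(C) = wt(D_r)` for `1 ≤ r ≤ k`. -/
def ChainCondition (C : Submodule F (Ambient F m n)) : Prop :=
  ∃ D : ℕ → Submodule F (Ambient F m n),
    D 0 = ⊥ ∧ D (Module.finrank F C) = C ∧
    (∀ r < Module.finrank F C, D r < D (r + 1)) ∧
    ∀ r ∈ Finset.Icc 1 (Module.finrank F C), genWeight C r = wt (D r)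

end Codes

/-- The sequence `d` is non-decreasing with values in `[n_1 + ⋯ + n_t]`, and the integer
`n_1 + ⋯ + n_{i-1} + j` appears in it at most `m_i` times for all `i ∈ [t]`, `j ∈ [n_i]`. -/
def IsAdmissible {t : ℕ} (m n : Fin t → ℕ) {k : ℕ} (d : Fin k → ℕ) : Prop :=
  Monotone d ∧ (∀ r, d r ∈ Finset.Icc 1 (∑ i, n i)) ∧
    ∀ i : Fin t, ∀ j ∈ Finset.Icc 1 (n i),
      (Finset.univ.filter fun r : Fin k => d r = ∑ l ∈ Finset.Iio i, n l + j).card ≤ m i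

end SumRank

/-!
Necessity: every optimal anticode of `F^{m_i × n_i}` of maximum rank `r + 1` contains an optimal
anticode of maximum rank `r`, of codimension `m_i`. This follows from the classification of optimal
anticodes (all matrices with column space, or all with row space, in a fixed subspace), which rests
on the spaces of leading columns of an anticode: vectors chosen independently in `s` of them are
columns of a member of the anticode of rank at least `s`. Cutting one factor of an optimal
anticode that contains a subcode thus lowers its weight at the cost of at most `m_i` dimensions.
Since `m_1 ≥ ⋯ ≥ m_t`, and a factor that can be cut lies in block `i` or later as soon as the
weight exceeds `n_1 + ⋯ + n_{i-1}`, no value `n_1 + ⋯ + n_{i-1} + j` occurs more than `m_i` times.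

Sufficiency: an MSRD code of minimum distance `p = n_1 + ⋯ + n_{i-1} + j` meets the space of tuples
supported on the first `p` of the `n` columns in dimension at least `m_i`. Independent vectors
chosen in these intersections at the levels `p = d_1, …, d_k` span a code in which the first `r`
of them have weight at most `d_r`, while the last `k - r + 1` of them lie in an MSRD code of
minimum distance `d_r` and hence meet every `r`-dimensional subcode in a vector of weight at least
`d_r`. So the first `r` vectors realise the `r`-th generalized weight, and a chain realising all
generalized weights makes the greedy weights coincide with them.
-/

namespace SumRank

open Module

section LinearMaps

variable {F V W : Type*} [Field F] [AddCommGroup V] [Module F V] [AddCommGroup W] [Module F W]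

theorem linearIndependent_update_iff {ι : Type*} [DecidableEq ι] {w : ι → W}
    (hw : LinearIndependent F w) {j : ι} {z : W} :
    LinearIndependent F (Function.update w j z) ↔ z ∉ Submodule.span F (w '' {j}ᶜ) := by
  have heq : Set.EqOn (Function.update w j z) w {j}ᶜ := fun l hl => Function.update_of_ne hl _ _
  rw [← linearIndepOn_univ_iff, ← Set.union_compl_self {j}, Set.singleton_union,
    linearIndepOn_insert (by simp), heq.image_eq, Function.update_self]
  exact and_iff_right ((hw.linearIndepOn (s := {j}ᶜ)).congr heq.symm)

theorem exists_linearIndependent_update_add_smul {ι : Type*} [DecidableEq ι] {w : ι → W}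
    (hw : LinearIndependent F w) (j : ι) (y : W) :
    ∃ c : F, LinearIndependent F (Function.update w j (y + c • w j)) := by
  simp only [linearIndependent_update_iff hw]
  by_contra! h
  have hy := h 0
  rw [zero_smul, add_zero] at hy
  refine linearIndependent_iff_notMem_span.1 hw j ?_
  simpa [Set.compl_eq_univ_sdiff] using (Submodule.add_mem_iff_right _ hy).1 (h 1)

theorem finrank_map_add_finrank_inf_ker [FiniteDimensional F V] (f : V →ₗ[F] W)
    (p : Submodule F V) :
    finrank F (p.map f) + finrank F (p ⊓ LinearMap.ker f : Submodule F V) = finrank F p := by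
  rw [← LinearMap.finrank_range_add_finrank_ker (f.domRestrict p), LinearMap.range_domRestrict,
    LinearMap.ker_domRestrict, ← Submodule.map_comap_subtype,
    (Submodule.equivSubtypeMap p ((LinearMap.ker f).comap p.subtype)).finrank_eq]

theorem finrank_add_finrank_le_finrank_inf_comap_add [FiniteDimensional F V]
    [FiniteDimensional F W] {f : V →ₗ[F] W} {D : Submodule F V} {A B : Submodule F W}
    (hD : D ≤ A.comap f) (hB : B ≤ A) :
    finrank F D + finrank F B ≤ finrank F (D ⊓ B.comap f : Submodule F V) + finrank F A := by
  have hsplitD := finrank_map_add_finrank_inf_ker (B.mkQ ∘ₗ f) D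
  have hsplitA := finrank_map_add_finrank_inf_ker B.mkQ A
  rw [LinearMap.ker_comp, B.ker_mkQ, Submodule.map_comp] at hsplitD
  rw [B.ker_mkQ, inf_eq_right.2 hB] at hsplitA
  have := Submodule.finrank_mono
    (Submodule.map_mono (f := B.mkQ) (Submodule.map_le_iff_le_comap.2 hD))
  omega

theorem card_le_finrank_range [FiniteDimensional F W] {ι : Type*} [Fintype ι] {X : V →ₗ[F] W}
    {b : ι → V} (h : LinearIndependent F (X ∘ b)) :
    Fintype.card ι ≤ finrank F (LinearMap.range X) :=
  (LinearIndependent.of_comp (v := X.rangeRestrict ∘ b) (LinearMap.range X).subtype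
    h).fintype_card_le_finrank

section Lead

variable {ι : Type*} [LinearOrder ι] {A : Submodule F (V →ₗ[F] W)} {b : ι → V}

/-- The space of leading values of `A` at `b j`: the values at `b j` of the maps in `A` that
vanish at all earlier members of the family `b`. In terms of matrices: the `j`-th columns of
the members of `A` whose earlier columns are zero. -/
def lead (A : Submodule F (V →ₗ[F] W)) (b : ι → V) (j : ι) : Submodule F W :=
  (A ⊓ ⨅ i < j, LinearMap.ker (LinearMap.applyₗ (b i))).map (LinearMap.applyₗ (b j))

theorem mem_lead {j : ι} {w : W} :
    w ∈ lead A b j ↔ ∃ X ∈ A, (∀ i < j, X (b i) = 0) ∧ X (b j) = w := by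
  simp [lead, and_assoc]

theorem finrank_eq_sum_finrank_lead [Fintype ι] [FiniteDimensional F V] [FiniteDimensional F W]
    (hb : Submodule.span F (Set.range b) = ⊤) :
    finrank F A = ∑ j, finrank F (lead A b j) := by
  have key : ∀ s : Finset ι, IsLowerSet (s : Set ι) →
      finrank F A = ∑ j ∈ s, finrank F (lead A b j) +
        finrank F (A ⊓ ⨅ i ∈ s, LinearMap.ker (LinearMap.applyₗ (b i)) :
          Submodule F (V →ₗ[F] W)) := by
    intro s hs
    induction s using Finset.induction_on_max with
    | empty => rw [Finset.sum_empty, zero_add, ← Finset.inf_eq_iInf, Finset.inf_empty, inf_top_eq]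
    | insert j s hj ih =>
      have hlt : ∀ i, i ∈ s ↔ i < j := fun i => ⟨hj i, fun hi =>
        (Finset.mem_insert.1 (hs hi.le (Finset.mem_insert_self j s))).resolve_left hi.ne⟩
      have hlow : IsLowerSet (s : Set ι) := fun i l hl hi => (hlt l).2 (hl.trans_lt (hj i hi))
      have hlead : lead A b j = (A ⊓ ⨅ i ∈ s, LinearMap.ker (LinearMap.applyₗ (b i))).map
          (LinearMap.applyₗ (b j)) := by simp only [lead, hlt]
      rw [ih hlow, Finset.sum_insert fun h => (hj j h).false, Finset.iInf_insert, inf_left_comm,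
        inf_comm (LinearMap.ker _), add_comm (finrank F (lead A b j)), add_assoc,
        add_right_inj, ← finrank_map_add_finrank_inf_ker (LinearMap.applyₗ (b j)), hlead]
  rw [key Finset.univ (by simpa using isLowerSet_univ), add_eq_left, Submodule.finrank_eq_zero,
    eq_bot_iff]
  rintro X ⟨-, hX⟩
  exact LinearMap.ext_on_range hb (by simpa using hX)

theorem eq_zero_of_forall_lead_eq_bot_or [Finite ι] (hb : Submodule.span F (Set.range b) = ⊤)
    {X : V →ₗ[F] W} (hX : X ∈ A) (h : ∀ j, lead A b j = ⊥ ∨ X (b j) = 0) : X = 0 := by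
  have hzero : ∀ j, X (b j) = 0 := fun j => by
    induction j using WellFoundedLT.induction with
    | ind j ih =>
      exact (h j).elim (fun hj => (Submodule.eq_bot_iff _).1 hj _ (mem_lead.2 ⟨X, hX, ih, rfl⟩)) id
  exact LinearMap.ext_on_range hb hzero

/-- The columns of a single map are built from left to right: once the earlier ones are in
place, adding a multiple of a map that realises the leading value `w j` changes only the columns
from `j` on. -/
theorem exists_linearIndependent_comp [Finite ι] {w : ι → W} (hw : LinearIndependent F w)
    (hlead : ∀ j, w j ∈ lead A b j) : ∃ X ∈ A, LinearIndependent F (X ∘ b) := by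
  classical
  have := Fintype.ofFinite ι
  have key : ∀ s : Finset ι, ∃ X ∈ A, LinearIndependent F (s.piecewise (X ∘ b) w) := by
    intro s
    induction s using Finset.induction_on_max with
    | empty => exact ⟨0, A.zero_mem, by simpa using hw⟩
    | insert j s hj ih =>
      obtain ⟨Y, hY, hYw⟩ := ih
      obtain ⟨Z, hZ, hZ0, hZj⟩ := mem_lead.1 (hlead j)
      obtain ⟨c, hc⟩ := exists_linearIndependent_update_add_smul hYw j (Y (b j))
      refine ⟨Y + c • Z, A.add_mem hY (A.smul_mem c hZ), ?_⟩
      convert hc using 1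
      have hjs : j ∉ s := fun h => (hj j h).false
      rw [Finset.piecewise_insert, Finset.piecewise_eq_of_notMem _ _ _ hjs]
      congr 1
      · exact s.piecewise_congr (fun i hi => by simp [hZ0 i (hj i hi)]) fun _ _ => rfl
      · simp [hZj]
  simpa using key Finset.univ

theorem card_le_of_linearIndepOn_lead [FiniteDimensional F W] {a : ℕ}
    (hA : ∀ X ∈ A, finrank F (LinearMap.range X) ≤ a) {J : Finset ι} {w : ι → W}
    (hw : LinearIndepOn F w J) (hlead : ∀ j ∈ J, w j ∈ lead A b j) : J.card ≤ a := by
  have hlead' : ∀ j : J, w j ∈ lead A (fun i : J => b i) j := fun j => by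
    obtain ⟨X, hX, hX0, hXj⟩ := mem_lead.1 (hlead j j.2)
    exact mem_lead.2 ⟨X, hX, fun i hi => hX0 i hi, hXj⟩
  obtain ⟨X, hX, hXb⟩ := exists_linearIndependent_comp hw.linearIndependent hlead'
  simpa using (card_le_finrank_range hXb).trans (hA X hX)

end Lead

section Transversals

variable {ι : Type*} {S : ι → Submodule F W}

theorem exists_linearIndepOn_insert [DecidableEq ι] {J : Finset ι} {w : ι → W}
    (hw : ∀ l ∈ J, w l ∈ S l) (hli : LinearIndepOn F w J) {j : ι} (hj : j ∉ J)
    (h : ¬ S j ≤ Submodule.span F (w '' J)) :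
    ∃ w' : ι → W, Set.EqOn w w' J ∧ (∀ l ∈ insert j J, w' l ∈ S l) ∧
      LinearIndepOn F w' (insert j J : Finset ι) := by
  obtain ⟨x, hxS, hx⟩ := Set.not_subset.1 h
  have heq : Set.EqOn w (Function.update w j x) J := fun l hl =>
    (Function.update_of_ne (ne_of_mem_of_not_mem hl hj) _ _).symm
  refine ⟨Function.update w j x, heq, ?_, ?_⟩
  · rw [Finset.forall_mem_insert, Function.update_self]
    exact ⟨hxS, fun l hl => heq hl ▸ hw l hl⟩
  · rw [Finset.coe_insert, linearIndepOn_insert (by simpa using hj), ← heq.image_eq,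
      Function.update_self]
    exact ⟨hli.congr heq, hx⟩

theorem finrank_span_image_le_card (w : ι → W) (J : Finset ι) :
    finrank F (Submodule.span F (w '' J)) ≤ J.card := by
  classical
  rw [← Finset.coe_image]
  exact (finrank_span_finset_le_card _).trans Finset.card_image_le

theorem exists_linearIndepOn_extend [FiniteDimensional F W] {J T : Finset ι} {w : ι → W}
    (hJT : J ⊆ T) (hw : ∀ l ∈ J, w l ∈ S l) (hli : LinearIndepOn F w J)
    (hS : ∀ l ∈ T, T.card ≤ finrank F (S l)) :
    ∃ w' : ι → W, Set.EqOn w w' J ∧ (∀ l ∈ T, w' l ∈ S l) ∧ LinearIndepOn F w' T := by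
  classical
  have key : ∀ R : Finset ι, J ∪ R ⊆ T → ∃ w' : ι → W, Set.EqOn w w' J ∧
      (∀ l ∈ J ∪ R, w' l ∈ S l) ∧ LinearIndepOn F w' (J ∪ R : Finset ι) := by
    intro R
    induction R using Finset.induction_on with
    | empty => exact fun _ => ⟨w, Set.eqOn_refl w J, by simpa using hw, by simpa using hli⟩
    | insert l R _ ih =>
      rw [Finset.union_insert, Finset.insert_subset_iff]
      rintro ⟨hlT, hRT⟩
      obtain ⟨v, hwv, hv, hvli⟩ := ih hRT
      by_cases hl : l ∈ J ∪ R
      · rw [Finset.insert_eq_of_mem hl]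
        exact ⟨v, hwv, hv, hvli⟩
      have hlt : (J ∪ R).card < T.card :=
        Finset.card_lt_card ⟨hRT, fun h => hl (h hlT)⟩
      obtain ⟨v', hvv', hv'⟩ := exists_linearIndepOn_insert hv hvli hl fun hle =>
        (hlt.trans_le ((hS l hlT).trans (Submodule.finrank_mono hle))).not_ge
          (finrank_span_image_le_card v _)
      exact ⟨v', hwv.trans (hvv'.mono (Finset.coe_subset.2 Finset.subset_union_left)), hv'⟩
  simpa [Finset.union_eq_right.2 hJT] using key T (Finset.union_subset hJT subset_rfl)

/-- Hall's condition for subspaces, in the form in which it is met by a greedy choice. -/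
theorem exists_linearIndepOn_transversal [FiniteDimensional F W] (r : ℕ) (T : Finset ι)
    (h : ∀ i < r, r ≤ i + (T.filter fun j => i < finrank F (S j)).card) :
    ∃ J ⊆ T, J.card = r ∧ ∃ w : ι → W, (∀ j ∈ J, w j ∈ S j) ∧ LinearIndepOn F w J := by
  classical
  induction r generalizing T with
  | zero => exact ⟨∅, by simp, rfl, 0, by simp, by simp⟩
  | succ r ih =>
    obtain ⟨j, hj⟩ : (T.filter fun j => r < finrank F (S j)).Nonempty :=
      Finset.card_pos.1 (by have := h r (by omega); omega)
    obtain ⟨hjT, hjr⟩ := Finset.mem_filter.1 hj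
    obtain ⟨J, hJT, rfl, w, hw, hli⟩ := ih (T.erase j) fun i hi => by
      rw [Finset.filter_erase, Finset.card_erase_of_mem (Finset.mem_filter.2 ⟨hjT, by omega⟩)]
      have := h i (by omega)
      omega
    have hjJ : j ∉ J := fun h' => Finset.notMem_erase j T (hJT h')
    obtain ⟨w', -, hw'⟩ := exists_linearIndepOn_insert hw hli hjJ fun hle =>
      (hjr.trans_le (Submodule.finrank_mono hle)).not_ge (finrank_span_image_le_card w J)
    exact ⟨insert j J, Finset.insert_subset hjT (hJT.trans (T.erase_subset j)),
      Finset.card_insert_of_notMem hjJ, w', hw'⟩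

theorem exists_linearIndepOn_of_ne [Fintype ι] [FiniteDimensional F W] {a : ℕ}
    (hS : ∀ j, finrank F (S j) = a) (ha : a < Fintype.card ι) {i j : ι} (hij : S i ≠ S j) :
    ∃ J : Finset ι, J.card = a + 1 ∧ ∃ w : ι → W, (∀ l ∈ J, w l ∈ S l) ∧ LinearIndepOn F w J := by
  classical
  obtain ⟨x, hxi, hxj⟩ := Set.not_subset.1 fun h =>
    hij (Submodule.eq_of_le_of_finrank_eq h ((hS i).trans (hS j).symm))
  have hx : x ≠ 0 := fun h => hxj (h ▸ (S j).zero_mem)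
  have ha0 : 1 ≤ a :=
    hS i ▸ Submodule.one_le_finrank_iff.2 ((Submodule.ne_bot_iff _).2 ⟨x, hxi, hx⟩)
  have hi : {i} ⊆ Finset.univ.erase j := by simpa using fun h => hij (congrArg S h)
  obtain ⟨T, hiT, hTj, rfl⟩ := Finset.exists_subsuperset_card_eq (n := a) hi (by simpa using ha0) <|
    by rw [Finset.card_erase_of_mem (Finset.mem_univ j), Finset.card_univ]; omega
  obtain ⟨w, hxw, hw, hli⟩ := exists_linearIndepOn_extend (S := S) (w := fun _ => x) hiT
    (by simpa using hxi) (by simpa using hx) fun l _ => (hS l).ge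
  have hjT : j ∉ T := fun h => Finset.notMem_erase j _ (hTj h)
  obtain ⟨w', -, hw'⟩ := exists_linearIndepOn_insert hw hli hjT fun hle => hxj <| by
    rw [Submodule.eq_of_le_of_finrank_le hle ((finrank_span_image_le_card w T).trans (hS j).ge)]
    exact Submodule.subset_span ⟨i, hiT (Finset.mem_singleton_self i), (hxw (by simp)).symm⟩
  exact ⟨insert j T, Finset.card_insert_of_notMem hjT, w', hw'⟩

end Transversals

section Rigidity

variable {ι : Type*} [Fintype ι] [FiniteDimensional F W]

theorem exists_linearIndependent_extend {J : Finset ι} {w : ι → W} (hli : LinearIndepOn F w J)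
    (hι : Fintype.card ι ≤ finrank F W) :
    ∃ w' : ι → W, Set.EqOn w w' J ∧ LinearIndependent F w' := by
  obtain ⟨w', heq, -, hw'⟩ := exists_linearIndepOn_extend (S := fun _ => ⊤) (Finset.subset_univ J)
    (fun _ _ => trivial) hli fun _ _ => by simpa using hι
  exact ⟨w', heq, by simpa using hw'⟩

theorem exists_linearIndependent_apply_eq_notMem_span (hι : Fintype.card ι < finrank F W)
    {y z : W} (hyz : LinearIndependent F ![y, z]) (j : ι) :
    ∃ w : ι → W, w j = y ∧ LinearIndependent F w ∧ z ∉ Submodule.span F (Set.range w) := by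
  classical
  have hli : LinearIndepOn F (fun o : Option ι => o.elim z fun _ => y)
      ({none, some j} : Finset (Option ι)) := by
    rw [Finset.coe_pair, LinearIndepOn.pair_iff _ (by simp)]
    exact LinearIndependent.pair_iff.1 (LinearIndependent.pair_symm_iff.1 hyz)
  obtain ⟨w, hw, hwli⟩ := exists_linearIndependent_extend hli (by simpa using hι)
  rw [linearIndependent_option] at hwli
  have hz : w none = z := (hw (by simp)).symm
  exact ⟨w ∘ some, (hw (by simp)).symm, hwli.1, hz ▸ hwli.2⟩

variable {φ : (ι → W) →ₗ[F] W}

theorem not_linearIndependent_apply_single [DecidableEq ι] (hι : Fintype.card ι < finrank F W)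
    (hφ : ∀ w, LinearIndependent F w → φ w ∈ Submodule.span F (Set.range w)) (i : ι) (y : W) :
    ¬ LinearIndependent F ![y, φ (Pi.single i y)] := by
  set z := φ (Pi.single i y)
  intro hyz
  have hy : y ≠ 0 := hyz.ne_zero 0
  by_cases hi : ∃ j, j ≠ i
  · obtain ⟨j, hji⟩ := hi
    obtain ⟨w, rfl, hw, hzw⟩ := exists_linearIndependent_apply_eq_notMem_span hι hyz j
    have hwj : w j ∈ Submodule.span F (w '' {i}ᶜ) := Submodule.subset_span ⟨j, hji, rfl⟩
    have hupdate : w + Pi.single i (w j) = Function.update w i (w i + w j) := by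
      rw [Pi.update_eq_sub_add_single, Pi.single_add]
      abel
    have hw' : LinearIndependent F (w + Pi.single i (w j)) := by
      rw [hupdate, linearIndependent_update_iff hw, Submodule.add_mem_iff_left _ hwj]
      simpa [Set.compl_eq_univ_sdiff] using linearIndependent_iff_notMem_span.1 hw i
    have hspan : Submodule.span F (Set.range (w + Pi.single i (w j))) ≤
        Submodule.span F (Set.range w) := by
      rw [Submodule.span_le]
      rintro _ ⟨l, rfl⟩
      refine add_mem (Submodule.subset_span ⟨l, rfl⟩) ?_
      obtain rfl | hl := eq_or_ne l i
      · simpa using Submodule.subset_span (Set.mem_range_self j)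
      · simp [hl]
    have hsum := hspan (hφ _ hw')
    rw [map_add, Submodule.add_mem_iff_right _ (hφ w hw)] at hsum
    exact hzw hsum
  · push Not at hi
    let : Unique ι := ⟨⟨i⟩, hi⟩
    have hdefault : Pi.single (M := fun _ => W) i y default = y :=
      Pi.single_eq_same (M := fun _ => W) i y
    have hz := hφ (Pi.single i y) (linearIndependent_unique_iff.2 (by rwa [hdefault]))
    rw [Set.range_unique, hdefault, Submodule.mem_span_singleton] at hz
    obtain ⟨c, hc⟩ := hz
    exact (LinearIndependent.pair_iff' hy).1 hyz c hc

theorem exists_forall_apply_eq_sum_smul (hι : Fintype.card ι < finrank F W)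
    (hφ : ∀ w, LinearIndependent F w → φ w ∈ Submodule.span F (Set.range w)) :
    ∃ c : ι → F, ∀ w, φ w = ∑ i, c i • w i := by
  classical
  have hc : ∀ i, ∃ c : F, φ ∘ₗ LinearMap.single F (fun _ => W) i = c • 1 := fun i =>
    LinearMap.exists_eq_smul_id_of_forall_notLinearIndependent fun y =>
      not_linearIndependent_apply_single hι hφ i y
  choose c hc using hc
  refine ⟨c, fun w => ?_⟩
  conv_lhs => rw [← Finset.univ_sum_single w, map_sum]
  exact Finset.sum_congr rfl fun i _ => LinearMap.congr_fun (hc i) (w i)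

end Rigidity

end LinearMaps

section Counting

variable {ι : Type*} [Fintype ι] {s : ι → ℕ} {a i m : ℕ}

theorem sum_le_card_mul_add (hs : ∀ j, s j ≤ m)
    (hi : (Finset.univ.filter fun j => i < s j).card ≤ a) :
    ∑ j, s j ≤ Fintype.card ι * i + a * (m - i) := calc
  ∑ j, s j ≤ ∑ j, (i + if i < s j then m - i else 0) :=
    Finset.sum_le_sum fun j _ => by have := hs j; split_ifs <;> omega
  _ = Fintype.card ι * i + (Finset.univ.filter fun j => i < s j).card * (m - i) := by
    rw [Finset.sum_add_distrib, ← Finset.sum_filter]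
    simp
  _ ≤ _ := by gcongr

theorem sum_le_mul_of_card_filter_lt (hs : ∀ j, s j ≤ m) (ha : a ≤ Fintype.card ι)
    (hm : Fintype.card ι ≤ m) (hia : i ≤ a)
    (hi : i + (Finset.univ.filter fun j => i < s j).card ≤ a) : ∑ j, s j ≤ m * a := by
  refine (sum_le_card_mul_add (i := i) (a := a - i) hs (by omega)).trans ?_
  obtain ⟨c, rfl⟩ := Nat.exists_eq_add_of_le hia
  obtain ⟨e, rfl⟩ := Nat.exists_eq_add_of_le (hia.trans (ha.trans hm))
  rw [Nat.add_sub_cancel_left, Nat.add_sub_cancel_left]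
  nlinarith

theorem eq_zero_or_eq_of_sum_eq_mul (hs : ∀ j, s j ≤ m) (ha : a ≤ Fintype.card ι)
    (hm : Fintype.card ι ≤ m) (hia : i ≤ a)
    (hi : i + (Finset.univ.filter fun j => i < s j).card ≤ a) (hsum : ∑ j, s j = m * a) :
    (∀ j, s j = 0 ∨ s j = m) ∨ (m = Fintype.card ι ∧ ∀ j, s j = a) := by
  have hbound := sum_le_card_mul_add (i := i) (a := a - i) hs (by omega)
  obtain ⟨c, rfl⟩ := Nat.exists_eq_add_of_le hia
  obtain ⟨e, rfl⟩ := Nat.exists_eq_add_of_le (hia.trans (ha.trans hm))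
  rw [hsum, Nat.add_sub_cancel_left, Nat.add_sub_cancel_left] at hbound
  rcases i.eq_zero_or_pos with rfl | hpos
  · left
    have hle : ∀ j ∈ Finset.univ, s j ≤ if 0 < s j then 0 + e else 0 := fun j _ => by
      have := hs j
      split_ifs <;> omega
    have heq := (Finset.sum_eq_sum_iff_of_le hle).1 <| (Finset.sum_le_sum hle).antisymm <| by
      rw [← Finset.sum_filter, Finset.sum_const, smul_eq_mul, hsum, mul_comm]
      gcongr
      omega
    intro j
    have := heq j (Finset.mem_univ j)
    split_ifs at this <;> omega
  · right
    obtain ⟨rfl, hcard⟩ : c = 0 ∧ i + e = Fintype.card ι := by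
      have : i * (e + c) ≤ i * (Fintype.card ι - i) := by
        rw [Nat.mul_sub]
        apply Nat.le_sub_of_add_le
        nlinarith
      have := Nat.le_of_mul_le_mul_left this hpos
      omega
    rw [add_zero] at hi hsum ⊢
    have hempty : (Finset.univ.filter fun j => i < s j) = ∅ := Finset.card_eq_zero.1 (by omega)
    have hle : ∀ j ∈ Finset.univ, s j ≤ i := fun j hj =>
      not_lt.1 (Finset.filter_eq_empty_iff.1 hempty hj)
    refine ⟨hcard, fun j => (Finset.sum_eq_sum_iff_of_le hle).1 ?_ j (Finset.mem_univ j)⟩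
    rw [hsum, hcard, Finset.sum_const, Finset.card_univ, smul_eq_mul]

end Counting

section Anticodes

variable {F V W : Type*} [Field F] [AddCommGroup V] [Module F V] [AddCommGroup W] [Module F W]
  [FiniteDimensional F W] {A : Submodule F (V →ₗ[F] W)} {a : ℕ}

theorem exists_add_card_filter_finrank_lead_le {ι : Type*} [Fintype ι] [LinearOrder ι]
    (hA : ∀ X ∈ A, finrank F (LinearMap.range X) ≤ a) (b : ι → V) :
    ∃ i ≤ a, i + (Finset.univ.filter fun j => i < finrank F (lead A b j)).card ≤ a := by
  by_contra! h
  obtain ⟨J, -, hJ, w, hw, hli⟩ := exists_linearIndepOn_transversal (S := lead A b) (a + 1)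
    Finset.univ fun i hi => h i (Nat.lt_succ_iff.1 hi)
  have := card_le_of_linearIndepOn_lead hA hli hw
  omega

theorem finrank_le_mul_of_finrank_range_le [FiniteDimensional F V]
    (hVW : finrank F V ≤ finrank F W)
    (hA : ∀ X ∈ A, finrank F (LinearMap.range X) ≤ a) : finrank F A ≤ finrank F W * a := by
  rcases le_total (finrank F V) a with hV | hV
  · refine (Submodule.finrank_le A).trans ?_
    rw [finrank_linearMap, mul_comm]
    gcongr
  · obtain ⟨i, hia, hi⟩ := exists_add_card_filter_finrank_lead_le hA (finBasis F V)
    rw [finrank_eq_sum_finrank_lead (finBasis F V).span_eq]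
    exact sum_le_mul_of_card_filter_lt (fun j => Submodule.finrank_le _) (by simpa) (by simpa)
      hia hi

theorem span_range_comp_eq_range {ι : Type*} [Fintype ι] {X : V →ₗ[F] W} {u : ι → V}
    (hX : finrank F (LinearMap.range X) ≤ Fintype.card ι) (hu : LinearIndependent F (X ∘ u)) :
    Submodule.span F (Set.range (X ∘ u)) = LinearMap.range X := by
  refine Submodule.eq_of_le_of_finrank_le ?_ (by rwa [finrank_span_eq_card hu])
  rw [Submodule.span_le]
  rintro _ ⟨i, rfl⟩
  exact X.mem_range_self _

theorem exists_forall_mem_apply_eq_sum_smul {ι : Type*} [Fintype ι]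
    (hA : ∀ X ∈ A, finrank F (LinearMap.range X) ≤ Fintype.card ι)
    (hcard : finrank F A = finrank F W * Fintype.card ι) (hι : Fintype.card ι < finrank F W)
    {u : ι → V} (hu : ∀ X ∈ A, X ∘ u = 0 → X = 0) (v : V) :
    ∃ c : ι → F, ∀ X ∈ A, X v = ∑ i, c i • X (u i) := by
  classical
  let evalAt : A →ₗ[F] ι → W := LinearMap.pi fun i => LinearMap.applyₗ (u i) ∘ₗ A.subtype
  have hinj : Function.Injective evalAt := (injective_iff_map_eq_zero evalAt).2 fun X hX =>
    Subtype.ext (hu X X.2 hX)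
  let e := LinearEquiv.ofInjectiveOfFinrankEq evalAt hinj (by
    rw [hcard, finrank_pi_fintype, Finset.sum_const, Finset.card_univ, smul_eq_mul, mul_comm])
  have he : ∀ w i, (e.symm w : V →ₗ[F] W) (u i) = w i := fun w =>
    congrFun (e.apply_symm_apply w)
  obtain ⟨c, hc⟩ := exists_forall_apply_eq_sum_smul
    (φ := LinearMap.applyₗ v ∘ₗ A.subtype ∘ₗ e.symm.toLinearMap) hι fun w hw => by
      have hwu : (e.symm w : V →ₗ[F] W) ∘ u = w := funext (he w)
      rw [← hwu, span_range_comp_eq_range (hA _ (e.symm w).2) (hwu.symm ▸ hw)]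
      exact LinearMap.mem_range.2 ⟨v, by rw [hwu]; rfl⟩
  refine ⟨c, fun X hX => ?_⟩
  have := hc (e ⟨X, hX⟩)
  rw [LinearMap.comp_apply, LinearMap.comp_apply, LinearEquiv.coe_coe, e.symm_apply_apply] at this
  exact this

theorem exists_linearIndependent_comp_apply_eq (X : V →ₗ[F] W) {v : V} (hv : X v ≠ 0) :
    ∃ (i : Fin (finrank F (LinearMap.range X))) (u : Fin (finrank F (LinearMap.range X)) → V),
      IsBot i ∧ u i = v ∧ LinearIndependent F (X ∘ u) := by
  have hpos : 0 < finrank F (LinearMap.range X) :=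
    Submodule.one_le_finrank_iff.2 ((Submodule.ne_bot_iff _).2 ⟨X v, X.mem_range_self v, hv⟩)
  obtain ⟨w, hw, hwli⟩ := exists_linearIndependent_extend (F := F) (ι := Fin _)
    (J := {⟨0, hpos⟩}) (w := fun _ => X.rangeRestrict v)
    (by simpa [Subtype.ext_iff] using hv) (Fintype.card_fin _).le
  have hex : ∀ i, ∃ x, X x = w i ∧ (i = ⟨0, hpos⟩ → x = v) := fun i => by
    rcases eq_or_ne i ⟨0, hpos⟩ with rfl | hi
    · exact ⟨v, congrArg Subtype.val (hw (by simp)), fun _ => rfl⟩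
    · obtain ⟨x, hx⟩ := (w i).2
      exact ⟨x, hx, fun h => absurd h hi⟩
  choose u hu hu0 using hex
  refine ⟨⟨0, hpos⟩, u, fun i => Nat.zero_le i, hu0 _ rfl, ?_⟩
  rw [show X ∘ u = (LinearMap.range X).subtype ∘ w from funext hu]
  exact hwli.map' _ (Submodule.ker_subtype _)

section Classification

variable {X₀ : V →ₗ[F] W} {ι κ : Type*} [Fintype ι] {u : ι → V} {k : κ → V}

theorem apply_mem_range_of_comp_eq_zero
    (hA : ∀ X ∈ A, finrank F (LinearMap.range X) ≤ Fintype.card ι) (hX₀ : X₀ ∈ A)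
    (hu : LinearIndependent F (X₀ ∘ u)) {X : V →ₗ[F] W} (hX : X ∈ A) (hXu : X ∘ u = 0) {v : V}
    (hv : X₀ v = 0) : X v ∈ LinearMap.range X₀ := by
  have hsum : (X₀ + X) ∘ u = X₀ ∘ u := funext fun i => by
    simpa using congrFun hXu i
  have hrange := span_range_comp_eq_range (hA _ (A.add_mem hX₀ hX)) (hsum.symm ▸ hu)
  rw [hsum, span_range_comp_eq_range (hA _ hX₀) hu] at hrange
  rw [hrange]
  exact ⟨v, by simp [hv]⟩

theorem span_range_elim_eq_top (hι : finrank F (LinearMap.range X₀) ≤ Fintype.card ι)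
    (hu : LinearIndependent F (X₀ ∘ u))
    (hk : Submodule.span F (Set.range k) = LinearMap.ker X₀) :
    Submodule.span F (Set.range (Sum.elim u k)) = ⊤ := by
  rw [Set.Sum.elim_range, Submodule.span_union, hk, ← Submodule.comap_map_eq, Submodule.map_span,
    ← Set.range_comp, span_range_comp_eq_range hι hu, LinearMap.range_le_iff_comap.1 le_rfl]

variable [LinearOrder ι] [LinearOrder κ]

theorem lead_inr_le_range
    (hA : ∀ X ∈ A, finrank F (LinearMap.range X) ≤ Fintype.card ι) (hX₀ : X₀ ∈ A)
    (hu : LinearIndependent F (X₀ ∘ u)) {j : κ} (hj : X₀ (k j) = 0) :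
    lead A (Sum.elim u k ∘ ofLex) (Sum.inrₗ j) ≤ LinearMap.range X₀ := by
  intro w hw
  obtain ⟨X, hX, hXu, rfl⟩ := mem_lead.1 hw
  exact apply_mem_range_of_comp_eq_zero hA hX₀ hu hX
    (funext fun i => hXu (Sum.inlₗ i) (Sum.Lex.inl_lt_inr i j)) hj

theorem ker_le_ker_of_forall_lead_eq_bot [Finite κ]
    (hA : ∀ X ∈ A, finrank F (LinearMap.range X) ≤ Fintype.card ι) (hX₀ : X₀ ∈ A)
    (hcard : finrank F A = finrank F W * Fintype.card ι) (hι : Fintype.card ι < finrank F W)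
    (hu : LinearIndependent F (X₀ ∘ u))
    (hk : Submodule.span F (Set.range k) = LinearMap.ker X₀)
    (hlead : ∀ j : κ, lead A (Sum.elim u k ∘ ofLex) (Sum.inrₗ j) = ⊥)
    {X : V →ₗ[F] W} (hX : X ∈ A) : LinearMap.ker X₀ ≤ LinearMap.ker X := by
  have := Fintype.ofFinite κ
  intro v hv
  have hinj : ∀ Y ∈ A, Y ∘ u = 0 → Y = 0 := fun Y hY hYu => by
    refine eq_zero_of_forall_lead_eq_bot_or (A := A) (b := Sum.elim u k ∘ ofLex) ?_ hY ?_
    · rw [ofLex.surjective.range_comp]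
      exact span_range_elim_eq_top (hA _ hX₀) hu hk
    · rintro (i | j)
      exacts [Or.inr (congrFun hYu i), Or.inl (hlead j)]
  obtain ⟨c, hc⟩ := exists_forall_mem_apply_eq_sum_smul hA hcard hι hinj v
  have hc0 : ∀ i, c i = 0 := Fintype.linearIndependent_iff.1 hu c
    ((hc X₀ hX₀).symm.trans (LinearMap.mem_ker.1 hv))
  rw [LinearMap.mem_ker, hc X hX]
  simp [hc0]

theorem lead_eq_lead_of_forall_finrank_eq {a : ℕ} {b : ι → V}
    (hA : ∀ X ∈ A, finrank F (LinearMap.range X) ≤ a) (ha : a < Fintype.card ι)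
    (hlead : ∀ j, finrank F (lead A b j) = a) (i j : ι) : lead A b i = lead A b j := by
  by_contra hij
  obtain ⟨J, hJ, w, hw, hli⟩ := exists_linearIndepOn_of_ne hlead ha hij
  have := card_le_of_linearIndepOn_lead hA hli hw
  omega

theorem ker_le_ker_or_apply_mem_range [FiniteDimensional F V] [Fintype κ]
    (hA : ∀ X ∈ A, finrank F (LinearMap.range X) ≤ Fintype.card ι) (hX₀ : X₀ ∈ A)
    (hcard : finrank F A = finrank F W * Fintype.card ι)
    (hu : LinearIndependent F (X₀ ∘ u))
    (hk : Submodule.span F (Set.range k) = LinearMap.ker X₀) (hκ : 0 < Fintype.card κ)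
    (hικ : Fintype.card ι + Fintype.card κ ≤ finrank F W) {i : ι} (hi : IsBot i) :
    (∀ X ∈ A, LinearMap.ker X₀ ≤ LinearMap.ker X) ∨
      (finrank F W = Fintype.card ι + Fintype.card κ ∧ ∀ X ∈ A, X (u i) ∈ LinearMap.range X₀) := by
  have hcard_lex : Fintype.card (ι ⊕ₗ κ) = Fintype.card ι + Fintype.card κ := by
    rw [Fintype.card_lex, Fintype.card_sum]
  have hb : Submodule.span F (Set.range (Sum.elim u k ∘ ofLex)) = ⊤ := by
    rw [ofLex.surjective.range_comp]
    exact span_range_elim_eq_top (hA _ hX₀) hu hk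
  have hrange : ∀ j : κ,
      lead A (Sum.elim u k ∘ ofLex) (Sum.inrₗ j) ≤ LinearMap.range X₀ := fun j =>
    lead_inr_le_range hA hX₀ hu
      (LinearMap.mem_ker.1 (hk ▸ Submodule.subset_span (Set.mem_range_self j)))
  obtain ⟨s, hs, hs'⟩ := exists_add_card_filter_finrank_lead_le hA (Sum.elim u k ∘ ofLex)
  rcases eq_zero_or_eq_of_sum_eq_mul (fun j => Submodule.finrank_le _) (by omega) (by omega) hs hs'
    ((finrank_eq_sum_finrank_lead hb).symm.trans hcard) with hlead | ⟨hW, hlead⟩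
  · have hzero : ∀ j : κ, lead A (Sum.elim u k ∘ ofLex) (Sum.inrₗ j) = ⊥ := fun j => by
      have hj := (Submodule.finrank_mono (hrange j)).trans (hA _ hX₀)
      exact Submodule.finrank_eq_zero.1 ((hlead _).resolve_right (by omega))
    exact Or.inl fun X hX =>
      ker_le_ker_of_forall_lead_eq_bot hA hX₀ hcard (by omega) hu hk hzero hX
  · obtain ⟨j⟩ := Fintype.card_pos_iff.1 hκ
    have heq := lead_eq_lead_of_forall_finrank_eq hA (by omega) hlead (Sum.inlₗ i) (Sum.inrₗ j)
    refine Or.inr ⟨hW.trans hcard_lex, fun X hX => hrange j ?_⟩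
    rw [← heq]
    refine mem_lead.2 ⟨X, hX, fun l hl => absurd hl ?_, rfl⟩
    rcases l with l | l
    exacts [(Sum.Lex.inl_le_inl_iff.2 (hi l)).not_gt, Sum.Lex.not_inr_lt_inl]

end Classification

section Extremal

variable [FiniteDimensional F V] {X₀ : V →ₗ[F] W}

theorem forall_ker_le_ker_or_forall_apply_mem_range (hVW : finrank F V ≤ finrank F W)
    (hA : ∀ X ∈ A, finrank F (LinearMap.range X) ≤ finrank F (LinearMap.range X₀))
    (hX₀ : X₀ ∈ A) (hcard : finrank F A = finrank F W * finrank F (LinearMap.range X₀))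
    (hker : LinearMap.ker X₀ ≠ ⊥) {v : V} (hv : X₀ v ≠ 0) :
    (∀ X ∈ A, LinearMap.ker X₀ ≤ LinearMap.ker X) ∨
      (finrank F W = finrank F V ∧ ∀ X ∈ A, X v ∈ LinearMap.range X₀) := by
  obtain ⟨i, u, hi, rfl, hu⟩ := exists_linearIndependent_comp_apply_eq X₀ hv
  have hk : Submodule.span F (Set.range ((LinearMap.ker X₀).subtype ∘
      finBasis F (LinearMap.ker X₀))) = LinearMap.ker X₀ := by
    rw [Set.range_comp, ← Submodule.map_span, Basis.span_eq, Submodule.map_subtype_top]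
  have hdim := LinearMap.finrank_range_add_finrank_ker X₀
  rw [← hdim] at hVW ⊢
  simpa using ker_le_ker_or_apply_mem_range (by simpa using hA) hX₀ (by simpa using hcard) hu hk
    (by rw [Fintype.card_fin]; exact Submodule.one_le_finrank_iff.2 hker) (by simpa using hVW) hi

/-- By dimension, both inclusions are equalities: an optimal anticode is given by prescribing a
subspace of the kernel or a space that contains the image. -/
theorem forall_ker_le_ker_or_forall_range_le_range (hVW : finrank F V ≤ finrank F W)
    (hA : ∀ X ∈ A, finrank F (LinearMap.range X) ≤ finrank F (LinearMap.range X₀))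
    (hX₀ : X₀ ∈ A) (hcard : finrank F A = finrank F W * finrank F (LinearMap.range X₀)) :
    (∀ X ∈ A, LinearMap.ker X₀ ≤ LinearMap.ker X) ∨
      (finrank F W = finrank F V ∧ ∀ X ∈ A, LinearMap.range X ≤ LinearMap.range X₀) := by
  rcases eq_or_ne (LinearMap.ker X₀) ⊥ with hker | hker
  · exact Or.inl fun X _ => hker ▸ bot_le
  rcases eq_or_ne X₀ 0 with rfl | hne
  · rw [LinearMap.range_zero, finrank_bot, mul_zero, Submodule.finrank_eq_zero] at hcard
    exact Or.inl fun X hX => by rw [(Submodule.eq_bot_iff A).1 hcard X hX]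
  refine or_iff_not_imp_left.2 fun hleft => ?_
  have hmem := fun v hv => (forall_ker_le_ker_or_forall_apply_mem_range (v := v) hVW hA hX₀ hcard
    hker hv).resolve_left hleft
  obtain ⟨v₀, hv₀⟩ := DFunLike.ne_iff.1 hne
  refine ⟨(hmem v₀ hv₀).1, fun X hX => ?_⟩
  rintro _ ⟨v, rfl⟩
  by_cases hv : X₀ v = 0
  · have h := (hmem (v + v₀) (by simpa [hv] using hv₀)).2 X hX
    rw [map_add] at h
    exact (Submodule.add_mem_iff_left _ ((hmem v₀ hv₀).2 X hX)).1 h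
  · exact (hmem v hv).2 X hX

theorem exists_le_finrank_add_of_finrank_range_le {r : ℕ} (hVW : finrank F V ≤ finrank F W)
    (hA : ∀ X ∈ A, finrank F (LinearMap.range X) ≤ r + 1)
    (hcard : finrank F A = finrank F W * (r + 1)) (hX₀ : X₀ ∈ A)
    (hr : finrank F (LinearMap.range X₀) = r + 1) :
    ∃ B ≤ A, finrank F A ≤ finrank F B + finrank F W ∧
      ∀ X ∈ B, finrank F (LinearMap.range X) ≤ r := by
  rcases forall_ker_le_ker_or_forall_range_le_range hVW (hr ▸ hA) hX₀ (hr ▸ hcard) with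
    hleft | ⟨hWV, hright⟩
  · have hne : X₀ ≠ 0 := by
      rintro rfl
      rw [LinearMap.range_zero, finrank_bot] at hr
      omega
    obtain ⟨v, hv⟩ := DFunLike.ne_iff.1 hne
    refine ⟨A ⊓ LinearMap.ker (LinearMap.applyₗ v), inf_le_left, ?_, ?_⟩
    · rw [← finrank_map_add_finrank_inf_ker (LinearMap.applyₗ v), add_comm]
      exact Nat.add_le_add_left (Submodule.finrank_le _) _
    · rintro X ⟨hX, hXv⟩
      have hlt := Submodule.finrank_lt_finrank_of_lt
        ((hleft X hX).lt_of_not_ge fun hle => hv (hle (show v ∈ LinearMap.ker X from hXv)))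
      have := LinearMap.finrank_range_add_finrank_ker X
      have := LinearMap.finrank_range_add_finrank_ker X₀
      omega
  · have hne : LinearMap.range X₀ ≠ ⊥ := fun h => by
      rw [h, finrank_bot] at hr
      omega
    obtain ⟨w, hw, hw0⟩ := (Submodule.ne_bot_iff _).1 hne
    obtain ⟨θ, hθ, -⟩ := Submodule.exists_le_ker_of_notMem (p := (⊥ : Submodule F W)) hw0
    refine ⟨A ⊓ LinearMap.ker (LinearMap.compRight F θ), inf_le_left, ?_, ?_⟩
    · rw [← finrank_map_add_finrank_inf_ker (LinearMap.compRight F θ) A, add_comm]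
      refine Nat.add_le_add_left ((Submodule.finrank_le _).trans ?_) _
      rw [finrank_linearMap, finrank_self, mul_one, hWV]
    · rintro X ⟨hX, hXθ⟩
      have hwX : w ∉ LinearMap.range X := by
        rintro ⟨v, rfl⟩
        exact hθ (LinearMap.congr_fun (LinearMap.mem_ker.1 hXθ) v)
      have hlt := Submodule.finrank_lt_finrank_of_lt
        ((hright X hX).lt_of_not_ge fun hle => hwX (hle hw))
      omega

end Extremal

end Anticodes

section Matrices

variable {F : Type*} [Field F] {a b r : ℕ} {A : Submodule F (Matrix (Fin a) (Fin b) F)}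

/-- The largest rank of a matrix in `A`; the set is nonempty and bounded by `b`. -/
noncomputable def maxRank (A : Submodule F (Matrix (Fin a) (Fin b) F)) : ℕ :=
  sSup {w | ∃ X ∈ A, X.rank = w}

theorem isGreatest_maxRank (A : Submodule F (Matrix (Fin a) (Fin b) F)) :
    IsGreatest {w | ∃ X ∈ A, X.rank = w} (maxRank A) := by
  have hbdd : BddAbove {w | ∃ X ∈ A, X.rank = w} := ⟨b, by
    rintro _ ⟨X, -, rfl⟩
    exact X.rank_le_width⟩
  exact ⟨Nat.sSup_mem ⟨_, 0, A.zero_mem, rfl⟩ hbdd, fun _ hw => le_csSup hbdd hw⟩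

theorem rank_le_maxRank {X : Matrix (Fin a) (Fin b) F} (hX : X ∈ A) : X.rank ≤ maxRank A :=
  (isGreatest_maxRank A).2 ⟨X, hX, rfl⟩

theorem exists_rank_eq_maxRank (A : Submodule F (Matrix (Fin a) (Fin b) F)) :
    ∃ X ∈ A, X.rank = maxRank A :=
  (isGreatest_maxRank A).1

theorem maxRank_le (h : ∀ X ∈ A, X.rank ≤ r) : maxRank A ≤ r := by
  obtain ⟨X, hX, hr⟩ := exists_rank_eq_maxRank A
  exact hr ▸ h X hX

theorem maxRank_le_width (A : Submodule F (Matrix (Fin a) (Fin b) F)) : maxRank A ≤ b :=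
  maxRank_le fun X _ => X.rank_le_width

theorem isOptimalAnticode_iff : IsOptimalAnticode A ↔ finrank F A = a * maxRank A := by
  have hgreatest : IsGreatest {w | ∃ X ∈ A, a * X.rank = w} (a * maxRank A) := by
    obtain ⟨X, hX, hr⟩ := exists_rank_eq_maxRank A
    refine ⟨⟨X, hX, by rw [hr]⟩, ?_⟩
    rintro _ ⟨Y, hY, rfl⟩
    exact Nat.mul_le_mul_left a (rank_le_maxRank hY)
  rw [IsOptimalAnticode, hgreatest.csSup_eq]

theorem finrank_range_le_of_mem_map_toLin' (h : ∀ X ∈ A, X.rank ≤ r)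
    {f : (Fin b → F) →ₗ[F] Fin a → F} (hf : f ∈ A.map Matrix.toLin'.toLinearMap) :
    finrank F (LinearMap.range f) ≤ r := by
  obtain ⟨X, hX, rfl⟩ := hf
  exact h X hX

theorem finrank_le_mul_of_rank_le (hba : b ≤ a) (h : ∀ X ∈ A, X.rank ≤ r) :
    finrank F A ≤ a * r := by
  have := finrank_le_mul_of_finrank_range_le (by simpa)
    fun _ => finrank_range_le_of_mem_map_toLin' h
  rwa [LinearEquiv.finrank_map_eq, finrank_fin_fun] at this

theorem isOptimalAnticode_and_maxRank_eq (hba : b ≤ a) (hrb : r ≤ b)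
    (h : ∀ X ∈ A, X.rank ≤ r) (hr : a * r ≤ finrank F A) : IsOptimalAnticode A ∧ maxRank A = r := by
  have hle := finrank_le_mul_of_rank_le hba fun _ => rank_le_maxRank (A := A)
  have heq : maxRank A = r := (maxRank_le h).antisymm <| by
    rcases a.eq_zero_or_pos with rfl | ha
    · omega
    · exact Nat.le_of_mul_le_mul_left (hr.trans hle) ha
  exact ⟨isOptimalAnticode_iff.2 (hle.antisymm (heq ▸ hr)), heq⟩

theorem isOptimalAnticode_top (hba : b ≤ a) :
    IsOptimalAnticode (⊤ : Submodule F (Matrix (Fin a) (Fin b) F)) :=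
  (isOptimalAnticode_and_maxRank_eq hba le_rfl (fun X _ => X.rank_le_width)
    (by simp [finrank_matrix])).1

theorem IsOptimalAnticode.exists_maxRank_eq (hA : IsOptimalAnticode A) (hba : b ≤ a)
    (hr : maxRank A = r + 1) :
    ∃ B ≤ A, IsOptimalAnticode B ∧ maxRank B = r := by
  rw [isOptimalAnticode_iff, hr] at hA
  obtain ⟨X₀, hX₀, hrank⟩ := exists_rank_eq_maxRank A
  obtain ⟨B', hBA, hdim, hB⟩ := exists_le_finrank_add_of_finrank_range_le
    (A := A.map Matrix.toLin'.toLinearMap) (X₀ := Matrix.toLin' X₀) (by simpa)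
    (fun _ => finrank_range_le_of_mem_map_toLin' fun X hX => hr ▸ rank_le_maxRank hX)
    (by rw [LinearEquiv.finrank_map_eq, finrank_fin_fun, hA]) (Submodule.mem_map_of_mem hX₀)
    (hrank.trans hr)
  obtain ⟨B, rfl⟩ : ∃ B : Submodule F (Matrix (Fin a) (Fin b) F),
      B.map Matrix.toLin'.toLinearMap = B' :=
    ⟨_, Submodule.map_comap_eq_of_surjective Matrix.toLin'.surjective B'⟩
  rw [LinearEquiv.finrank_map_eq, LinearEquiv.finrank_map_eq, finrank_fin_fun, hA, mul_add_one,
    add_le_add_iff_right] at hdim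
  exact ⟨B, (Submodule.map_le_map_iff_of_injective Matrix.toLin'.injective _ _).1 hBA,
    isOptimalAnticode_and_maxRank_eq hba (by have := maxRank_le_width A; omega)
      (fun X hX => hB _ (Submodule.mem_map_of_mem hX)) hdim⟩

end Matrices

section Weights

variable {F : Type*} [Field F] {t : ℕ} {m n : Fin t → ℕ} {C D : Submodule F (Ambient F m n)}
  {X : Ambient F m n} {r : ℕ}

theorem maxSrk_pi (A : ∀ i, Submodule F (Matrix (Fin (m i)) (Fin (n i)) F)) :
    maxSrk (Submodule.pi Set.univ A) = ∑ i, maxRank (A i) := by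
  refine IsGreatest.csSup_eq ⟨?_, ?_⟩
  · choose X hX hr using fun i => exists_rank_eq_maxRank (A i)
    exact ⟨X, fun i _ => hX i, Finset.sum_congr rfl fun i _ => hr i⟩
  · rintro _ ⟨X, hX, rfl⟩
    exact Finset.sum_le_sum fun i _ => rank_le_maxRank (hX i trivial)

theorem wt_le {A : ∀ i, Submodule F (Matrix (Fin (m i)) (Fin (n i)) F)}
    (hA : ∀ i, IsOptimalAnticode (A i)) (hD : D ≤ Submodule.pi Set.univ A) :
    wt D ≤ ∑ i, maxRank (A i) :=
  Nat.sInf_le ⟨A, hA, hD, maxSrk_pi A⟩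

theorem exists_wt_eq (hnm : ∀ i, n i ≤ m i) (D : Submodule F (Ambient F m n)) :
    ∃ A : ∀ i, Submodule F (Matrix (Fin (m i)) (Fin (n i)) F),
      (∀ i, IsOptimalAnticode (A i)) ∧ D ≤ Submodule.pi Set.univ A ∧
        wt D = ∑ i, maxRank (A i) := by
  obtain ⟨A, hA, hD, hw⟩ := Nat.sInf_mem (s := {w | ∃ A : ∀ i,
    Submodule F (Matrix (Fin (m i)) (Fin (n i)) F), (∀ i, IsOptimalAnticode (A i)) ∧
      D ≤ Submodule.pi Set.univ A ∧ maxSrk (Submodule.pi Set.univ A) = w})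
    ⟨_, fun _ => ⊤, fun i => isOptimalAnticode_top (hnm i), by simp, rfl⟩
  exact ⟨A, hA, hD, hw.symm.trans (maxSrk_pi A)⟩

theorem srk_le_wt (hnm : ∀ i, n i ≤ m i) (hX : X ∈ D) : srk X ≤ wt D := by
  obtain ⟨A, -, hD, hw⟩ := exists_wt_eq hnm D
  rw [hw]
  exact Finset.sum_le_sum fun i _ => rank_le_maxRank (hD hX i trivial)

theorem wt_le_sum (hnm : ∀ i, n i ≤ m i) (D : Submodule F (Ambient F m n)) :
    wt D ≤ ∑ i, n i := by
  obtain ⟨A, -, -, hw⟩ := exists_wt_eq hnm D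
  rw [hw]
  exact Finset.sum_le_sum fun i _ => maxRank_le_width (A i)

theorem srk_pos (hX : X ≠ 0) : 0 < srk X := by
  obtain ⟨i, hi⟩ := Function.ne_iff.1 hX
  refine Finset.sum_pos' (fun _ _ => Nat.zero_le _) ⟨i, Finset.mem_univ i, Nat.pos_of_ne_zero ?_⟩
  rw [Matrix.rank, Ne, Submodule.finrank_eq_zero, LinearMap.range_eq_bot]
  exact fun h => hi (Matrix.toLin'.map_eq_zero_iff.1 h)

theorem wt_pos (hnm : ∀ i, n i ≤ m i) (hD : 0 < finrank F D) : 0 < wt D := by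
  obtain ⟨X, hX, hX0⟩ := (Submodule.ne_bot_iff D).1 (Submodule.one_le_finrank_iff.1 hD)
  exact (srk_pos hX0).trans_le (srk_le_wt hnm hX)

theorem wt_inf_comap_proj_add_le {A : ∀ i, Submodule F (Matrix (Fin (m i)) (Fin (n i)) F)}
    (hA : ∀ i, IsOptimalAnticode (A i)) (hD : D ≤ Submodule.pi Set.univ A) {l : Fin t}
    {B : Submodule F (Matrix (Fin (m l)) (Fin (n l)) F)} (hB : IsOptimalAnticode B) :
    wt (D ⊓ B.comap (LinearMap.proj l)) + maxRank (A l) ≤ maxRank B + ∑ i, maxRank (A i) := by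
  have hle : wt (D ⊓ B.comap (LinearMap.proj l)) ≤ ∑ i, maxRank (Function.update A l B i) :=
    wt_le ((Function.forall_update_iff A fun i => IsOptimalAnticode).2 ⟨hB, fun i _ => hA i⟩)
      fun X hX i _ => (Function.forall_update_iff A fun i (B : Submodule F _) => X i ∈ B).2
        ⟨hX.2, fun i _ => hD hX.1 i trivial⟩ i
  simp only [Function.apply_update (fun _ => maxRank)] at hle
  rw [Finset.sum_update_of_mem (Finset.mem_univ l)] at hle
  rw [Finset.sum_eq_add_sum_sdiff_singleton_of_mem (Finset.mem_univ l)]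
  omega

theorem exists_wt_lt (hnm : ∀ i, n i ≤ m i) (hm : Antitone m) (i : Fin t)
    (hD : ∑ l ∈ Finset.Iio i, n l < wt D) :
    ∃ D' ≤ D, finrank F D ≤ finrank F D' + m i ∧ wt D' < wt D := by
  obtain ⟨A, hA, hDA, hw⟩ := exists_wt_eq hnm D
  obtain ⟨l, hil, hl⟩ : ∃ l, i ≤ l ∧ maxRank (A l) ≠ 0 := by
    by_contra! hzero
    refine hD.not_ge ?_
    rw [hw, ← Finset.sum_subset (Finset.subset_univ (Finset.Iio i)) fun l _ hl =>
      hzero l (by simpa using hl)]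
    exact Finset.sum_le_sum fun l _ => maxRank_le_width (A l)
  obtain ⟨r, hr⟩ := Nat.exists_eq_succ_of_ne_zero hl
  obtain ⟨B, hBA, hB, rfl⟩ := (hA l).exists_maxRank_eq (hnm l) hr
  refine ⟨D ⊓ B.comap (LinearMap.proj l), inf_le_left, ?_, ?_⟩
  · have hdim : finrank F D + finrank F B ≤
        finrank F (D ⊓ B.comap (LinearMap.proj l) : Submodule F (Ambient F m n)) +
          finrank F (A l) :=
      finrank_add_finrank_le_finrank_inf_comap_add (fun X hX => hDA hX l trivial) hBA
    rw [isOptimalAnticode_iff.1 (hA l), isOptimalAnticode_iff.1 hB, hr, Nat.mul_succ] at hdim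
    have := hm hil
    omega
  · have := wt_inf_comap_proj_add_le hA hDA hB
    omega

theorem genWeight_le (hD : D ≤ C) (hr : r ≤ finrank F D) : genWeight C r ≤ wt D :=
  Nat.sInf_le ⟨D, hD, hr, rfl⟩

theorem exists_genWeight_eq (hr : r ≤ finrank F C) :
    ∃ D ≤ C, r ≤ finrank F D ∧ wt D = genWeight C r :=
  Nat.sInf_mem (s := {w | ∃ D ≤ C, r ≤ finrank F D ∧ wt D = w}) ⟨_, C, le_rfl, hr, rfl⟩

theorem lt_add_of_genWeight_eq (hnm : ∀ i, n i ≤ m i) (hm : Antitone m) (i : Fin t) {a b : ℕ}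
    (hb : b ≤ finrank F C) (hi : ∑ l ∈ Finset.Iio i, n l < genWeight C b)
    (hab : genWeight C a = genWeight C b) : b < a + m i := by
  by_contra! hle
  obtain ⟨D, hDC, hbD, hw⟩ := exists_genWeight_eq hb
  obtain ⟨D', hD', hdim, hlt⟩ := exists_wt_lt hnm hm i (hi.trans_eq hw.symm)
  have := genWeight_le (hD'.trans hDC) (r := a) (by omega)
  omega

theorem isAdmissible_genWeight (hnm : ∀ i, n i ≤ m i) (hm : Antitone m)
    (C : Submodule F (Ambient F m n)) {k : ℕ} {s : Fin k → ℕ} (hs : StrictMono s)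
    (hsC : ∀ r, s r ∈ Finset.Icc 1 (finrank F C)) :
    IsAdmissible m n fun r => genWeight C (s r) := by
  simp only [Finset.mem_Icc] at hsC
  refine ⟨fun a b hab => ?_, fun r => ?_, fun i j hj => ?_⟩
  · obtain ⟨D, hDC, hD, hw⟩ := exists_genWeight_eq (hsC b).2
    exact (genWeight_le hDC ((hs.monotone hab).trans hD)).trans_eq hw
  · obtain ⟨D, -, hD, hw⟩ := exists_genWeight_eq (hsC r).2
    exact Finset.mem_Icc.2 ⟨(wt_pos hnm ((hsC r).1.trans hD)).trans_eq hw,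
      hw.symm.trans_le (wt_le_sum hnm D)⟩
  · set S := Finset.univ.filter fun r => genWeight C (s r) = ∑ l ∈ Finset.Iio i, n l + j
    rcases S.eq_empty_or_nonempty with hS | hS
    · simp [hS]
    have hmem : ∀ r ∈ S, genWeight C (s r) = ∑ l ∈ Finset.Iio i, n l + j := fun r hr =>
      (Finset.mem_filter.1 hr).2
    have hsub : S.image s ⊆ Finset.Ico (s (S.min' hS)) (s (S.min' hS) + m i) := by
      refine Finset.image_subset_iff.2 fun r hr => Finset.mem_Ico.2
        ⟨hs.monotone (S.min'_le r hr), lt_add_of_genWeight_eq hnm hm i (hsC r).2 ?_ ?_⟩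
      · rw [hmem r hr]
        exact Nat.lt_add_of_pos_right (Finset.mem_Icc.1 hj).1
      · rw [hmem r hr, hmem _ (S.min'_mem hS)]
    simpa [Finset.card_image_of_injective S hs.injective] using Finset.card_le_card hsub

theorem IsGenWeightSeq.isAdmissible (hnm : ∀ i, n i ≤ m i) (hm : Antitone m) {k : ℕ}
    {d : Fin k → ℕ} (h : IsGenWeightSeq C d) : IsAdmissible m n d := by
  rw [← funext h.2]
  refine isAdmissible_genWeight hnm hm C (fun r s hrs => Nat.succ_lt_succ hrs) fun r => ?_
  rw [h.1]
  simp

end Weights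

section Greedy

variable {F : Type*} [Field F] {t : ℕ} {m n : Fin t → ℕ} {C D E : Submodule F (Ambient F m n)}
  {r : ℕ}

theorem IsGreedySubcode.wt_eq (hD : IsGreedySubcode C (r + 1) D)
    (hE : IsGreedySubcode C (r + 1) E) : wt D = wt E := by
  cases r with
  | zero => exact hD.2.2.trans hE.2.2.symm
  | succ r => exact (hD.2 E hE.1).antisymm (hE.2 D hD.1)

theorem IsGreedySubcode.greedyWeight_eq (hD : IsGreedySubcode C (r + 1) D) :
    greedyWeight C (r + 1) = wt D := by
  obtain ⟨E, hE, hw⟩ := Nat.sInf_mem (s := {w | ∃ D, IsGreedySubcode C (r + 1) D ∧ wt D = w})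
    ⟨_, D, hD, rfl⟩
  exact hw.symm.trans (hE.wt_eq hD)

theorem IsGreedySubcode.succ (hE : IsGreedySubcode C (r + 1) E) (hED : E ≤ D) (hDC : D ≤ C)
    (hD : finrank F D = r + 2) (hw : wt D = genWeight C (r + 2)) :
    IsGreedySubcode C (r + 2) D :=
  ⟨⟨hDC, hD, E, hED, hE⟩, fun _ h => hw.trans_le (genWeight_le h.1 h.2.1.ge)⟩

theorem finrank_eq_and_le_of_chain {V : Type*} [AddCommGroup V] [Module F V]
    [FiniteDimensional F V] {D : ℕ → Submodule F V} {k : ℕ} (hlt : ∀ r < k, D r < D (r + 1))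
    (hk : finrank F (D k) = k) {r : ℕ} (hr : r ≤ k) : finrank F (D r) = r ∧ D r ≤ D k := by
  have hfinrank_lt : ∀ r < k, finrank F (D r) < finrank F (D (r + 1)) := fun r hr =>
    Submodule.finrank_lt_finrank_of_lt (hlt r hr)
  have hge : r ≤ finrank F (D r) := by
    induction r with
    | zero => exact Nat.zero_le _
    | succ r ih => exact (ih (Nat.le_of_succ_le hr)).trans_lt (hfinrank_lt r hr)
  have hle : finrank F (D r) ≤ r ∧ D r ≤ D k := by
    clear hge
    induction hr using Nat.decreasingInduction with
    | self => exact ⟨hk.le, le_rfl⟩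
    | of_succ r hr ih =>
      exact ⟨Nat.lt_succ_iff.1 ((hfinrank_lt r hr).trans_le ih.1), (hlt r hr).le.trans ih.2⟩
  exact ⟨hle.1.antisymm hge, hle.2⟩

theorem ChainCondition.greedyWeight_eq_genWeight (h : ChainCondition C) (hr : r < finrank F C) :
    greedyWeight C (r + 1) = genWeight C (r + 1) := by
  obtain ⟨D, -, hD, hlt, hw⟩ := h
  have hfin : ∀ s ≤ finrank F C, finrank F (D s) = s ∧ D s ≤ C := fun s hs => by
    simpa only [hD] using finrank_eq_and_le_of_chain hlt (by rw [hD]) hs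
  have hw' : ∀ s < finrank F C, wt (D (s + 1)) = genWeight C (s + 1) := fun s hs =>
    (hw _ (Finset.mem_Icc.2 ⟨Nat.succ_pos s, hs⟩)).symm
  have hgreedy : IsGreedySubcode C (r + 1) (D (r + 1)) := by
    induction r with
    | zero => exact ⟨(hfin 1 hr).2, (hfin 1 hr).1, hw' 0 hr⟩
    | succ r ih =>
      exact (ih (Nat.lt_of_succ_lt hr)).succ (hlt _ hr).le (hfin _ hr).2 (hfin _ hr).1 (hw' _ hr)
  exact hgreedy.greedyWeight_eq.trans (hw' r hr)

theorem ChainCondition.isGreedyWeightSeq (h : ChainCondition C) {k : ℕ} {d : Fin k → ℕ}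
    (hd : IsGenWeightSeq C d) : IsGreedyWeightSeq C d :=
  ⟨hd.1, fun r => (h.greedyWeight_eq_genWeight (hd.1.symm ▸ r.2)).trans (hd.2 r)⟩

end Greedy

section Families

variable {F V ι : Type*} [Field F] [AddCommGroup V] [Module F V]

theorem finrank_submodule_pi [Fintype ι] {M : ι → Type*} [∀ i, AddCommGroup (M i)]
    [∀ i, Module F (M i)] [∀ i, FiniteDimensional F (M i)] (A : ∀ i, Submodule F (M i)) :
    finrank F (Submodule.pi Set.univ A) = ∑ i, finrank F (A i) := by
  let f : (∀ i, A i) →ₗ[F] ∀ i, M i := LinearMap.pi fun i => (A i).subtype ∘ₗ LinearMap.proj i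
  have hf : Function.Injective f := fun x y h => funext fun i => Subtype.ext (congr_fun h i)
  have hr : LinearMap.range f = Submodule.pi Set.univ A :=
    Submodule.ext fun X => ⟨fun ⟨x, hx⟩ i _ => hx ▸ (x i).2,
      fun hX => ⟨fun i => ⟨X i, hX i trivial⟩, rfl⟩⟩
  rw [← hr, LinearMap.finrank_range_of_inj hf, finrank_pi_fintype]

theorem finrank_span_image_eq_card {x : ι → V} (hx : LinearIndependent F x) (S : Finset ι) :
    finrank F (Submodule.span F (x '' (S : Set ι))) = S.card := by
  have hrange : x '' (S : Set ι) = Set.range (x ∘ ((↑) : S → ι)) := by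
    rw [Set.range_comp, Subtype.range_coe]
  rw [hrange, finrank_span_eq_card (hx.comp _ Subtype.val_injective), Fintype.card_coe]

theorem linearIndependent_of_disjoint_span_lt {x : ι → V} {d : ι → ℕ}
    (hfib : ∀ p, LinearIndepOn F x {r | d r = p})
    (hdisj : ∀ p, Disjoint (Submodule.span F (x '' {r | d r < p}))
      (Submodule.span F (x '' {r | d r = p}))) :
    LinearIndependent F x := by
  have hlt : ∀ p, LinearIndepOn F x {r | d r < p} := by
    intro p
    induction p with
    | zero => simp
    | succ p ih =>
      have hsucc : {r | d r < p + 1} = {r | d r < p} ∪ {r | d r = p} :=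
        Set.ext fun r => Nat.lt_succ_iff_lt_or_eq
      exact hsucc ▸ ih.union (hfib p) (hdisj p)
  have hdir : Directed (· ⊆ ·) fun p => {r | d r < p} :=
    Monotone.directed_le fun _ _ hpq _ hr => lt_of_lt_of_le hr hpq
  have huniv : ⋃ p, {r | d r < p} = Set.univ :=
    Set.eq_univ_of_forall fun r => Set.mem_iUnion.2 ⟨d r + 1, Nat.lt_succ_self _⟩
  exact linearIndepOn_univ_iff.1 (huniv ▸ linearIndepOn_iUnion_of_directed hdir hlt)

theorem exists_forall_linearIndepOn_fiber [Fintype ι] {β : Type*}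
    [DecidableEq β] {d : ι → β} {W : β → Submodule F V}
    (h : ∀ r, (Finset.univ.filter fun s => d s = d r).card ≤ finrank F (W (d r))) :
    ∃ x : ι → V, (∀ r, x r ∈ W (d r)) ∧ ∀ p, LinearIndepOn F x {r | d r = p} := by
  have hex : ∀ p, ∃ f : {r // d r = p} → W p, LinearIndependent F f := by
    intro p
    rcases isEmpty_or_nonempty {r // d r = p} with _ | ⟨r, rfl⟩
    · exact ⟨fun _ => 0, linearIndependent_empty_type⟩
    · obtain ⟨g, hg⟩ := exists_linearIndependent_of_le_finrank
        ((Fintype.card_subtype _).trans_le (h r))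
      exact ⟨_, hg.comp _ (Fintype.equivFin _).injective⟩
  choose f hf using hex
  refine ⟨fun r => f (d r) ⟨r, rfl⟩, fun r => (f (d r) _).2, fun p => ?_⟩
  have hfib : (fun r : {r // d r = p} => (f (d r) ⟨r, rfl⟩ : V)) = (W p).subtype ∘ f p := by
    funext ⟨r, hr⟩
    subst hr
    rfl
  have hli : LinearIndependent F ((W p).subtype ∘ f p) :=
    (hf p).map' (W p).subtype (W p).ker_subtype
  rwa [← hfib] at hli

end Families

section ColumnSupport

variable {F : Type*} [Field F] {a b c : ℕ}

/-- The matrices supported on their first `c` columns: the standard optimal anticode of maximum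
rank `c`. -/
def columnSupported (F : Type*) [Field F] (a b c : ℕ) :
    Submodule F (Matrix (Fin a) (Fin b) F) :=
  Submodule.pi Set.univ fun _ => Submodule.pi Set.univ fun y => if (y : ℕ) < c then ⊤ else ⊥

theorem mem_columnSupported {X : Matrix (Fin a) (Fin b) F} :
    X ∈ columnSupported F a b c ↔ ∀ x, ∀ y : Fin b, c ≤ y → X x y = 0 := by
  have hentry : ∀ (y : Fin b) (u : F),
      (u ∈ if (y : ℕ) < c then (⊤ : Submodule F F) else ⊥) ↔ (c ≤ y → u = 0) := fun y u => by
    split_ifs with hy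
    · simp [hy]
    · simp [not_lt.1 hy]
  exact ⟨fun h x y => (hentry y _).1 (h x trivial y trivial),
    fun h x _ y _ => (hentry y _).2 (h x y)⟩

theorem columnSupported_mono {c' : ℕ} (h : c ≤ c') :
    columnSupported F a b c ≤ columnSupported F a b c' := fun _ hX =>
  mem_columnSupported.2 fun x y hy => mem_columnSupported.1 hX x y (h.trans hy)

theorem rank_le_of_mem_columnSupported {X : Matrix (Fin a) (Fin b) F}
    (hX : X ∈ columnSupported F a b c) : X.rank ≤ c := by
  classical
  let w : Fin b → F := fun y => if (y : ℕ) < c then 1 else 0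
  have hXw : X * Matrix.diagonal w = X := by
    ext x y
    rw [Matrix.mul_diagonal]
    rcases lt_or_ge (y : ℕ) c with hy | hy
    · rw [show w y = 1 from if_pos hy, mul_one]
    · rw [mem_columnSupported.1 hX x y hy, zero_mul]
  calc X.rank ≤ (Matrix.diagonal w).rank := hXw ▸ Matrix.rank_mul_le_right X _
    _ = (Finset.univ.filter fun y : Fin b => (y : ℕ) < c).card := by
      simp [Matrix.rank_diagonal, w, Fintype.card_subtype]
    _ ≤ c := Fin.card_filter_val_lt.trans_le (min_le_right _ _)

theorem finrank_columnSupported (hcb : c ≤ b) : finrank F (columnSupported F a b c) = a * c := by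
  have hentry : ∀ y : Fin b, finrank F (if (y : ℕ) < c then ⊤ else ⊥ : Submodule F F) =
      if (y : ℕ) < c then 1 else 0 := fun y => by
    by_cases hy : (y : ℕ) < c
    · rw [if_pos hy, if_pos hy, finrank_top, finrank_self]
    · rw [if_neg hy, if_neg hy, finrank_bot]
  refine (finrank_submodule_pi (M := fun _ : Fin a => Fin b → F) _).trans ?_
  simp only [finrank_submodule_pi, hentry, Finset.sum_boole, Fin.card_filter_val_lt,
    min_eq_right hcb, Nat.cast_id, Finset.sum_const, Finset.card_univ, Fintype.card_fin,
    smul_eq_mul]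

theorem isOptimalAnticode_columnSupported (hcb : c ≤ b) (hba : b ≤ a) :
    IsOptimalAnticode (columnSupported F a b c) ∧ maxRank (columnSupported F a b c) = c :=
  isOptimalAnticode_and_maxRank_eq hba hcb (fun _ => rank_le_of_mem_columnSupported)
    (finrank_columnSupported hcb).ge

end ColumnSupport

section ColumnCount

/-- The number of columns of the `i`-th block among the first `p` columns, all blocks being put
side by side. -/
def columnCount {t : ℕ} (n : Fin t → ℕ) (p : ℕ) (i : Fin t) : ℕ :=
  min (n i) (p - ∑ l ∈ Finset.Iio i, n l)

theorem columnCount_mono {t : ℕ} (n : Fin t → ℕ) {p q : ℕ} (h : p ≤ q) (i : Fin t) :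
    columnCount n p i ≤ columnCount n q i :=
  min_le_min_left _ (Nat.sub_le_sub_right h _)

theorem sum_columnCount {t : ℕ} (n : Fin t → ℕ) (p : ℕ) :
    ∑ i, columnCount n p i = min p (∑ i, n i) := by
  induction t with
  | zero => simp
  | succ t ih =>
    have hcast : ∀ i : Fin t,
        columnCount n p i.castSucc = columnCount (fun i => n i.castSucc) p i := fun i => by
      simp only [columnCount, Fin.sum_Iio_castSucc]
    have hlast : columnCount n p (Fin.last t) =
        min (n (Fin.last t)) (p - ∑ i : Fin t, n i.castSucc) := by
      simp [columnCount, Fin.Iio_last_eq_map]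
    rw [Fin.sum_univ_castSucc, Fin.sum_univ_castSucc, hlast,
      Finset.sum_congr rfl fun i _ => hcast i, ih]
    omega

theorem sum_Iio_add_le {t : ℕ} (n : Fin t → ℕ) {i j : Fin t} (hij : i < j) :
    ∑ l ∈ Finset.Iio i, n l + n i ≤ ∑ l ∈ Finset.Iio j, n l := by
  rw [add_comm, ← Finset.sum_insert (by simp)]
  exact Finset.sum_le_sum_of_subset
    (Finset.insert_subset (Finset.mem_Iio.2 hij) (Finset.Iio_subset_Iio hij.le))

theorem sum_mul_columnCount {t : ℕ} {n : Fin t → ℕ} (f : Fin t → ℕ) {i : Fin t} {j : ℕ}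
    (hj : j ≤ n i) :
    ∑ l, f l * columnCount n (∑ l ∈ Finset.Iio i, n l + j) l =
      ∑ l ∈ Finset.Iio i, f l * n l + f i * j := by
  set p := ∑ l ∈ Finset.Iio i, n l + j with hp
  have hlt : ∀ l < i, columnCount n p l = n l := fun l hl => by
    have := sum_Iio_add_le n hl
    exact min_eq_left (by omega)
  have heq : columnCount n p i = j := by
    rw [columnCount, hp, Nat.add_sub_cancel_left, min_eq_right hj]
  have hgt : ∀ l, i < l → columnCount n p l = 0 := fun l hl => by
    have := sum_Iio_add_le n hl
    rw [columnCount, Nat.sub_eq_zero_of_le (by omega), Nat.min_zero]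
  rw [← Finset.sum_subset (Finset.subset_univ (Finset.Iic i)) fun l _ hl => by
    rw [hgt l (by simpa using hl), mul_zero], ← Finset.Iio_insert, Finset.sum_insert (by simp),
    heq, add_comm]
  exact congr_arg (· + f i * j)
    (Finset.sum_congr rfl fun l hl => by rw [hlt l (Finset.mem_Iio.1 hl)])

end ColumnCount

section FirstColumns

variable {F : Type*} [Field F] {t : ℕ} {m n : Fin t → ℕ} {D : Submodule F (Ambient F m n)}

/-- The matrix tuples supported on the first `p` columns, all blocks being put side by side. -/
def firstColumns (F : Type*) [Field F] (m n : Fin t → ℕ) (p : ℕ) :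
    Submodule F (Ambient F m n) :=
  Submodule.pi Set.univ fun i => columnSupported F (m i) (n i) (columnCount n p i)

theorem firstColumns_mono : Monotone (firstColumns F m n) := fun _ _ h _ hX i _ =>
  columnSupported_mono (columnCount_mono n h i) (hX i trivial)

theorem srk_le_of_mem_firstColumns {p : ℕ} {X : Ambient F m n} (hX : X ∈ firstColumns F m n p) :
    srk X ≤ p :=
  calc srk X ≤ ∑ i, columnCount n p i :=
        Finset.sum_le_sum fun i _ => rank_le_of_mem_columnSupported (hX i trivial)
    _ ≤ p := (sum_columnCount n p).trans_le (min_le_left _ _)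

theorem wt_le_of_le_firstColumns (hnm : ∀ i, n i ≤ m i) {p : ℕ} (hD : D ≤ firstColumns F m n p) :
    wt D ≤ p := by
  have hA := fun i => isOptimalAnticode_columnSupported (F := F) (c := columnCount n p i)
    (min_le_left _ _) (hnm i)
  calc wt D ≤ ∑ i, columnCount n p i :=
        (wt_le (fun i => (hA i).1) hD).trans_eq (Finset.sum_congr rfl fun i _ => (hA i).2)
    _ ≤ p := (sum_columnCount n p).trans_le (min_le_left _ _)

theorem finrank_firstColumns (p : ℕ) :
    finrank F (firstColumns F m n p) = ∑ i, m i * columnCount n p i := by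
  rw [firstColumns, finrank_submodule_pi]
  exact Finset.sum_congr rfl fun i _ => finrank_columnSupported (min_le_left _ _)

theorem minDist_le {X : Ambient F m n} (hX : X ∈ D) (h0 : X ≠ 0) : minDist D ≤ srk X :=
  Nat.sInf_le ⟨X, hX, h0, rfl⟩

theorem disjoint_firstColumns {p : ℕ} (hp : p < minDist D) : Disjoint (firstColumns F m n p) D :=
  Submodule.disjoint_def.2 fun _ hX hXD => by_contra fun h0 =>
    ((minDist_le hXD h0).trans (srk_le_of_mem_firstColumns hX)).not_gt hp

theorem finrank_ambient : finrank F (Ambient F m n) = ∑ i, m i * n i := by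
  simp [finrank_pi_fintype, finrank_matrix]

theorem IsMSRD.exists_le_finrank_inf (hD : IsMSRD D) :
    ∃ i, ∃ j ∈ Finset.Icc 1 (n i), minDist D = ∑ l ∈ Finset.Iio i, n l + j ∧
      m i ≤ finrank F (firstColumns F m n (minDist D) ⊓ D : Submodule F (Ambient F m n)) := by
  obtain ⟨i, δ, hδ, hd, hdim⟩ := hD
  refine ⟨i, δ + 1, Finset.mem_Icc.2 ⟨by omega, hδ⟩, hd, ?_⟩
  have hcols := finrank_firstColumns (F := F) (m := m) (n := n) (minDist D)
  rw [hd, add_assoc, sum_mul_columnCount m hδ, ← add_assoc, ← hd] at hcols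
  have hsplit : ∑ l ∈ Finset.Iio i, m l * n l + ∑ l ∈ Finset.Ici i, m l * n l =
      ∑ l, m l * n l := by
    simpa only [Finset.filter_gt_eq_Iio, not_lt, Finset.filter_le_eq_Ici] using
      Finset.sum_filter_add_sum_filter_not Finset.univ (· < i) fun l => m l * n l
  have hgrass := Submodule.finrank_sup_add_finrank_inf_eq (firstColumns F m n (minDist D)) D
  have hsup := Submodule.finrank_le (firstColumns F m n (minDist D) ⊔ D)
  rw [finrank_ambient] at hsup
  rw [Nat.mul_succ, mul_comm (m i)] at hcols
  omega

end FirstColumns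

section WeightBases

variable {F : Type*} [Field F] {t : ℕ} {m n : Fin t → ℕ} {k : ℕ} {x : Fin k → Ambient F m n}
  {d : Fin k → ℕ}

/-- A basis of a code that exhibits `d` as its sequence of generalized weights: the spans of the
initial segments bound the weights from above, and since every code of dimension at least `r + 1`
meets the span of the final segment starting at `r`, the latter bounds them from below. -/
structure IsWeightBasis (x : Fin k → Ambient F m n) (d : Fin k → ℕ) : Prop where
  linearIndependent : LinearIndependent F x
  wt_span_Iic_le (r : Fin k) : wt (Submodule.span F (x '' Finset.Iic r)) ≤ d r
  le_srk (r : Fin k) {X : Ambient F m n} (hX : X ∈ Submodule.span F (x '' Finset.Ici r))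
    (h0 : X ≠ 0) : d r ≤ srk X

namespace IsWeightBasis

theorem finrank_span_range (h : IsWeightBasis x d) :
    finrank F (Submodule.span F (Set.range x)) = k := by
  rw [finrank_span_eq_card h.linearIndependent, Fintype.card_fin]

theorem le_wt (h : IsWeightBasis x d) (hnm : ∀ i, n i ≤ m i) (r : Fin k)
    {G : Submodule F (Ambient F m n)} (hG : G ≤ Submodule.span F (Set.range x))
    (hr : (r : ℕ) < finrank F G) : d r ≤ wt G := by
  let H : Submodule F (Ambient F m n) := Submodule.span F (x '' Finset.Ici r)
  have hH : finrank F H = k - r := by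
    rw [finrank_span_image_eq_card h.linearIndependent, Fin.card_Ici]
  have hsup : finrank F (G ⊔ H : Submodule F (Ambient F m n)) ≤ k :=
    (Submodule.finrank_mono
      (sup_le hG (Submodule.span_mono (Set.image_subset_range _ _)))).trans_eq h.finrank_span_range
  have hgrass := Submodule.finrank_sup_add_finrank_inf_eq G H
  have hinf : G ⊓ H ≠ ⊥ := Submodule.one_le_finrank_iff.1 (by omega)
  obtain ⟨X, hX, h0⟩ := Submodule.exists_mem_ne_zero_of_ne_bot hinf
  exact (h.le_srk r hX.2 h0).trans (srk_le_wt hnm hX.1)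

theorem genWeight_eq (h : IsWeightBasis x d) (hnm : ∀ i, n i ≤ m i) (r : Fin k) :
    genWeight (Submodule.span F (Set.range x)) (r + 1) = d r ∧
      wt (Submodule.span F (x '' Finset.Iic r)) = d r := by
  have hle : Submodule.span F (x '' Finset.Iic r) ≤ Submodule.span F (Set.range x) :=
    Submodule.span_mono (Set.image_subset_range _ _)
  have hfin : finrank F (Submodule.span F (x '' Finset.Iic r)) = r + 1 := by
    rw [finrank_span_image_eq_card h.linearIndependent, Fin.card_Iic]
  obtain ⟨G, hG, hGr, hGw⟩ := exists_genWeight_eq (r.2.trans_eq h.finrank_span_range.symm)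
  exact ⟨((genWeight_le hle hfin.ge).trans (h.wt_span_Iic_le r)).antisymm
      ((h.le_wt hnm r hG hGr).trans_eq hGw),
    (h.wt_span_Iic_le r).antisymm (h.le_wt hnm r hle (by omega))⟩

theorem isGenWeightSeq (h : IsWeightBasis x d) (hnm : ∀ i, n i ≤ m i) :
    IsGenWeightSeq (Submodule.span F (Set.range x)) d :=
  ⟨h.finrank_span_range, fun r => (h.genWeight_eq hnm r).1⟩

theorem chainCondition (h : IsWeightBasis x d) (hnm : ∀ i, n i ≤ m i) :
    ChainCondition (Submodule.span F (Set.range x)) := by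
  let E : ℕ → Submodule F (Ambient F m n) := fun r =>
    Submodule.span F (x '' {s | (s : ℕ) < r})
  have hE : ∀ r : Fin k, E (r + 1) = Submodule.span F (x '' Finset.Iic r) := fun r => by
    simp only [E, Nat.lt_succ_iff, Finset.coe_Iic, ← Fin.le_def]
    rfl
  refine ⟨E, by simp [E], ?_, fun r hr => ?_, fun r hr => ?_⟩
  · simp [E, h.finrank_span_range]
  · rw [h.finrank_span_range] at hr
    refine (Submodule.span_mono (Set.image_mono fun s hs => Nat.lt_succ_of_lt hs)).lt_of_not_ge
      fun hle => ?_
    have hmem : x ⟨r, hr⟩ ∈ E r := hle (Submodule.subset_span ⟨_, Nat.lt_succ_self r, rfl⟩)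
    exact h.linearIndependent.notMem_span_image (lt_irrefl r) hmem
  · rw [h.finrank_span_range, Finset.mem_Icc] at hr
    obtain ⟨r, rfl⟩ := Nat.exists_eq_add_of_le' hr.1
    have hr := h.genWeight_eq hnm ⟨r, hr.2⟩
    exact hr.1.trans (hr.2.symm.trans (congr_arg wt (hE ⟨r, _⟩).symm))

end IsWeightBasis

end WeightBases

section MSRDChains

variable {F : Type*} [Field F] {t : ℕ} {m n : Fin t → ℕ} {D : ℕ → Submodule F (Ambient F m n)}
  {k : ℕ} {x : Fin k → Ambient F m n} {d : Fin k → ℕ}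

/-- A chain `D 1 ⊇ D 2 ⊇ ⋯ ⊇ D (n_1 + ⋯ + n_t)` of MSRD codes, where `D h` has minimum
distance `h`; the other values of `D` are irrelevant. -/
structure IsMSRDChain (D : ℕ → Submodule F (Ambient F m n)) : Prop where
  succ_le : ∀ h ∈ Finset.Ico 1 (∑ i, n i), D (h + 1) ≤ D h
  isMSRD_and_minDist : ∀ h ∈ Finset.Icc 1 (∑ i, n i), IsMSRD (D h) ∧ minDist (D h) = h

namespace IsMSRDChain

theorem antitoneOn (hD : IsMSRDChain D) : AntitoneOn D (Finset.Icc 1 (∑ i, n i)) := by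
  rw [Finset.coe_Icc]
  refine antitoneOn_of_add_one_le Set.ordConnected_Icc fun h _ h1 h2 => hD.succ_le h ?_
  exact Finset.mem_Ico.2 ⟨h1.1, h2.2⟩

theorem card_le_finrank_inf (hD : IsMSRDChain D) (hd : IsAdmissible m n d) (r : Fin k) :
    (Finset.univ.filter fun s => d s = d r).card ≤
      finrank F (firstColumns F m n (d r) ⊓ D (d r) : Submodule F (Ambient F m n)) := by
  obtain ⟨hMSRD, hdist⟩ := hD.isMSRD_and_minDist _ (hd.2.1 r)
  obtain ⟨i, j, hj, hij, hle⟩ := hMSRD.exists_le_finrank_inf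
  rw [hdist] at hij hle
  rw [hij] at hle ⊢
  exact (hd.2.2 i j hj).trans hle

theorem isWeightBasis (hD : IsMSRDChain D) (hnm : ∀ i, n i ≤ m i) (hd : IsAdmissible m n d)
    (hx : ∀ r, x r ∈ firstColumns F m n (d r) ⊓ D (d r))
    (hfib : ∀ p, LinearIndepOn F x {r | d r = p}) : IsWeightBasis x d where
  linearIndependent := by
    refine linearIndependent_of_disjoint_span_lt hfib fun p => ?_
    by_cases hp : ∃ r, d r = p
    · obtain ⟨r, rfl⟩ := hp
      have hpos := (Finset.mem_Icc.1 (hd.2.1 r)).1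
      have hdist := (hD.isMSRD_and_minDist _ (hd.2.1 r)).2
      have hdisj : Disjoint (firstColumns F m n (d r - 1)) (D (d r)) :=
        disjoint_firstColumns (by omega)
      refine hdisj.mono (Submodule.span_le.2 ?_) (Submodule.span_le.2 ?_)
      · rintro _ ⟨s, hs, rfl⟩
        exact firstColumns_mono (Nat.le_sub_one_of_lt hs) (hx s).1
      · rintro _ ⟨s, hs, rfl⟩
        exact hs ▸ (hx s).2
    · simp [not_exists.1 hp]
  wt_span_Iic_le r := by
    refine wt_le_of_le_firstColumns hnm (Submodule.span_le.2 ?_)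
    rintro _ ⟨s, hs, rfl⟩
    exact firstColumns_mono (hd.1 (Finset.mem_Iic.1 hs)) (hx s).1
  le_srk r X hX h0 := by
    have hle : Submodule.span F (x '' Finset.Ici r) ≤ D (d r) := by
      refine Submodule.span_le.2 ?_
      rintro _ ⟨s, hs, rfl⟩
      exact hD.antitoneOn (hd.2.1 r) (hd.2.1 s) (hd.1 (Finset.mem_Ici.1 hs)) (hx s).2
    exact (hD.isMSRD_and_minDist _ (hd.2.1 r)).2.ge.trans (minDist_le (hle hX) h0)

end IsMSRDChain

theorem IsAdmissible.exists_code (hd : IsAdmissible m n d) (hnm : ∀ i, n i ≤ m i)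
    (hD : IsMSRDChain D) : ∃ C : Submodule F (Ambient F m n),
      IsGenWeightSeq C d ∧ ChainCondition C ∧ IsGreedyWeightSeq C d := by
  obtain ⟨x, hx, hfib⟩ := exists_forall_linearIndepOn_fiber
    (W := fun p => firstColumns F m n p ⊓ D p) (hD.card_le_finrank_inf hd)
  have hbasis := hD.isWeightBasis hnm hd hx hfib
  exact ⟨_, hbasis.isGenWeightSeq hnm, hbasis.chainCondition hnm,
    (hbasis.chainCondition hnm).isGreedyWeightSeq (hbasis.isGenWeightSeq hnm)⟩

end MSRDChains

end SumRank

theorem theorem4p7_general {F : Type*} [Field F] {t : ℕ} (m n : Fin t → ℕ)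
    (hnm : ∀ i, n i ≤ m i) (hm : Antitone m)
    (hchain : ∃ D : ℕ → Submodule F (SumRank.Ambient F m n),
      (∀ h ∈ Finset.Ico 1 (∑ i, n i), D (h + 1) ≤ D h) ∧
      ∀ h ∈ Finset.Icc 1 (∑ i, n i), SumRank.IsMSRD (D h) ∧ SumRank.minDist (D h) = h) :
    (∀ (k : ℕ) (d : Fin k → ℕ),
      (∃ C : Submodule F (SumRank.Ambient F m n), SumRank.IsGenWeightSeq C d) ↔
        SumRank.IsAdmissible m n d) ∧
    (∀ (k : ℕ) (d : Fin k → ℕ), SumRank.IsAdmissible m n d →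
      ∃ C : Submodule F (SumRank.Ambient F m n), SumRank.IsGenWeightSeq C d ∧
        SumRank.ChainCondition C ∧ SumRank.IsGreedyWeightSeq C d) ∧
    (∀ (k : ℕ) (s : Fin k → ℕ), StrictMono s →
      (∀ r, s r ∈ Finset.Icc 1 (Module.finrank F (SumRank.Ambient F m n))) →
      ∃ C : Submodule F (SumRank.Ambient F m n),
        SumRank.IsGreedyWeightSeq C fun r =>
          SumRank.genWeight (⊤ : Submodule F (SumRank.Ambient F m n)) (s r)) := by
  obtain ⟨D, hle, hMSRD⟩ := hchain
  have hD : SumRank.IsMSRDChain D := ⟨hle, hMSRD⟩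
  refine ⟨fun k d => ⟨?_, fun hd => ?_⟩, fun k d hd => hd.exists_code hnm hD,
    fun k s hs hsr => ?_⟩
  · rintro ⟨C, hC⟩
    exact hC.isAdmissible hnm hm
  · obtain ⟨C, hC, -⟩ := hd.exists_code hnm hD
    exact ⟨C, hC⟩
  · obtain ⟨C, -, -, hC⟩ := (SumRank.isAdmissible_genWeight hnm hm ⊤ hs
      (by simpa only [finrank_top] using hsr)).exists_code hnm hD
    exact ⟨C, hC⟩

theorem theorem4p7 {F : Type*} [Field F] [Finite F] {t : ℕ} (ht : 0 < t) (m n : Fin t → ℕ)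
    (hn : ∀ i, 0 < n i) (hnm : ∀ i, n i ≤ m i) (hm : Antitone m)
    (hchain : ∃ D : ℕ → Submodule F (SumRank.Ambient F m n),
      D 1 = ⊤ ∧ (∀ h ∈ Finset.Ico 1 (∑ i, n i), D (h + 1) ≤ D h) ∧
      ∀ h ∈ Finset.Icc 1 (∑ i, n i), SumRank.IsMSRD (D h) ∧ SumRank.minDist (D h) = h) :
    (∀ (k : ℕ) (d : Fin k → ℕ),
      (∃ C : Submodule F (SumRank.Ambient F m n), SumRank.IsGenWeightSeq C d) ↔
        SumRank.IsAdmissible m n d) ∧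
    (∀ (k : ℕ) (d : Fin k → ℕ), SumRank.IsAdmissible m n d →
      ∃ C : Submodule F (SumRank.Ambient F m n), SumRank.IsGenWeightSeq C d ∧
        SumRank.ChainCondition C ∧ SumRank.IsGreedyWeightSeq C d) ∧
    (∀ (k : ℕ) (s : Fin k → ℕ), StrictMono s →
      (∀ r, s r ∈ Finset.Icc 1 (Module.finrank F (SumRank.Ambient F m n))) →
      ∃ C : Submodule F (SumRank.Ambient F m n),
        SumRank.IsGreedyWeightSeq C fun r =>
          SumRank.genWeight (⊤ : Submodule F (SumRank.Ambient F m n)) (s r)) :=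
  theorem4p7_general m n hnm hm (hchain.imp fun _ h => h.2)
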